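/- Let $\Delta$ be a densely ordered domain of constants, represented by binary words in such a way that distinct constants have distinct representations and the order of two given constants can be checked in polynomial time. A conjunctive query with comparisons $q$ consists of a summary row $\bar x$ of distinguished variables, a finite set of atoms $R(z_1,\dots,z_r)$ and a finite set of comparisons $z\,\sigma\,z'$ with $\sigma\in\{=,<,\le\}$, where the $z$'s are variables or constants from $\Delta$; variables and relation symbols are named by binary words, and $\mathrm{adom}(q)$ is the set of terms occurring in $q$. A linearization of $q$ is a linear arrangement, with ties allowed, of $\mathrm{adom}(q)$ that agrees with the order of $\Delta$ on constants and satisfies all comparisons of $q$; $q$ entails $r\,\sigma\,s$ (for $r,s\in\mathrm{adom}(q)$) if it holds in all linearizations of $q$. For queries $q_1,q_2$ with the same summary $\bar x$, a homomorphism $h\colon q_1\to q_2$ is a map $\mathrm{adom}(q_1)\to\mathrm{adom}(q_2)$ that is the identity on $\bar x$ and on constants, maps every atom of $q_1$ to an atom of $q_2$, and is such that $q_2$ entails $h(r)\,\sigma\,h(s)$ for every comparison $r\,\sigma\,s$ of $q_1$. An isomorphism is a bijection $\mathrm{adom}(q_1)\to\mathrm{adom}(q_2)$ that is the identity on $\bar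 x$ and on constants and preserves atoms and comparisons in both directions. A core of $q$ is a query $q'$ with the same summary such that (1) there is a homomorphism $q\to q'$; (2) for every query $q''$ with homomorphisms $q\to q''$ and $q''\to q$ there is an injective homomorphism $q'\to q''$; (3) the comparisons of $q'$ are exactly the comparisons $r\,\sigma\,s$, $r,s\in\mathrm{adom}(q')$, that $q'$ entails. Theorem. There is a function that assigns to every conjunctive query with comparisons $q$ a core of $q$ and that can be computed in $\Delta^p_3$, that is, by a deterministic polynomial-time machine with an oracle from $\Sigma^p_2$ (the query and its core being written as words in a standard way). Consequently, the equivalence test for conjunctive queries with comparisons that computes the cores of two given queries and checks whether they are isomorphic can also be carried out in $\Delta^p_3$. -/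

import Mathlib

/-! ### Words and their encodings -/

namespace PH

/-- Words over the binary alphabet. -/
abbrev Word : Type := List Bool

/-- A self-delimiting copy of a word: every bit is announced by `true`, the end by `false`. -/
def block (w : Word) : Word := w.flatMap (fun b => [true, b]) ++ [false]

/-- Encoding of a finite sequence of words as one word. -/
def tuple (l : List Word) : Word := l.flatMap block

/-! ### Oracle machines

The machine has finitely many stacks of bits (those mentioned in its program; a stack is a tape
that is read and written at one end only) and a structured finite program.  Each instruction
inspects or changes the top of one stack and costs one step.  The only exception is an oracle call,
which, as usual, hands over a whole word (written before, bit by bit) in one step. -/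

inductive Prog : Type
  | skip : Prog
  | push (r : ℕ) (b : Bool) : Prog
  | pop (r : ℕ) : Prog
  | seq (P Q : Prog) : Prog
  /-- Branch on the top of stack `r`: it is empty, or its top is `false`, or its top is `true`. -/
  | branch (r : ℕ) (onEmpty onFalse onTrue : Prog) : Prog
  /-- As long as stack `r` is not empty, run the body. -/
  | loop (r : ℕ) (body : Prog) : Prog
  /-- Replace the content of stack `r` by the oracle's one-bit answer about it. -/
  | ask (r : ℕ) : Prog

/-- The contents of the stacks, tops first. -/
abbrev Store : Type := ℕ → Word

/-- `Exec O P s s' t`: with oracle `O`, the program `P` started on the stacks `s` halts after exactly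
`t` steps with the stacks `s'`. -/
inductive Exec (O : Set Word) : Prog → Store → Store → ℕ → Prop
  | skip (s : Store) : Exec O Prog.skip s s 1
  | push (r : ℕ) (b : Bool) (s : Store) :
      Exec O (Prog.push r b) s (Function.update s r (b :: s r)) 1
  | pop (r : ℕ) (s : Store) :
      Exec O (Prog.pop r) s (Function.update s r (s r).tail) 1
  | seq {P Q : Prog} {s s' s'' : Store} {m n : ℕ} :
      Exec O P s s' m → Exec O Q s' s'' n → Exec O (Prog.seq P Q) s s'' (m + n)
  | branchEmpty {r : ℕ} {P Q R : Prog} {s s' : Store} {n : ℕ} :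
      s r = [] → Exec O P s s' n → Exec O (Prog.branch r P Q R) s s' (n + 1)
  | branchFalse {r : ℕ} {P Q R : Prog} {s s' : Store} {w : Word} {n : ℕ} :
      s r = false :: w → Exec O Q s s' n → Exec O (Prog.branch r P Q R) s s' (n + 1)
  | branchTrue {r : ℕ} {P Q R : Prog} {s s' : Store} {w : Word} {n : ℕ} :
      s r = true :: w → Exec O R s s' n → Exec O (Prog.branch r P Q R) s s' (n + 1)
  | loopDone {r : ℕ} {P : Prog} {s : Store} :
      s r = [] → Exec O (Prog.loop r P) s s 1
  | loopStep {r : ℕ} {P : Prog} {s s' s'' : Store} {m n : ℕ} :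
      s r ≠ [] → Exec O P s s' m → Exec O (Prog.loop r P) s' s'' n →
      Exec O (Prog.loop r P) s s'' (m + n + 1)
  | askYes {r : ℕ} {s : Store} :
      s r ∈ O → Exec O (Prog.ask r) s (Function.update s r [true]) 1
  | askNo {r : ℕ} {s : Store} :
      s r ∉ O → Exec O (Prog.ask r) s (Function.update s r [false]) 1

/-- The initial stacks: the input on stack `0`, all others empty. -/
def initial (w : Word) : Store := Function.update (fun _ => []) 0 w

/-- `f` is computed, with respect to the encodings `ea` and `eb`, by a deterministic machine with
oracle `O` whose running time is bounded by a polynomial in the length of the encoded input.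
The output is left on stack `0`. -/
def PolyTimeComputable {α β : Type*} (O : Set Word) (ea : α → Word) (eb : β → Word) (f : α → β) :
    Prop :=
  ∃ (P : Prog) (p : Polynomial ℕ), ∀ a : α, ∃ (s : Store) (t : ℕ),
    Exec O P (initial (ea a)) s t ∧ t ≤ p.eval (ea a).length ∧ s 0 = eb (f a)

/-- The class P (the empty oracle is no help). -/
def InP (L : Set Word) : Prop :=
  ∃ f : Word → Bool, (∀ w, f w = true ↔ w ∈ L) ∧ PolyTimeComputable ∅ id (fun b => [b]) f

/-- The classes `Σᵖₖ` of the polynomial hierarchy: `Σᵖ₀ = P`, and `Σᵖₖ₊₁` consists of the languages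
obtained from a language `M` in `Πᵖₖ` (that is, `Mᶜ` in `Σᵖₖ`) by one polynomially bounded
existential quantifier. -/
def InSigma : ℕ → Set Word → Prop
  | 0, L => InP L
  | k + 1, L => ∃ M : Set Word, InSigma k Mᶜ ∧ ∃ p : Polynomial ℕ,
      ∀ w, w ∈ L ↔ ∃ u : Word, u.length ≤ p.eval w.length ∧ tuple [w, u] ∈ M

/-- `f` can be computed in `Δᵖₖ`: by a deterministic polynomial-time machine, for `k + 1` with an
oracle from `Σᵖₖ`. -/
def ComputableInDelta {α β : Type*} (ea : α → Word) (eb : β → Word) (f : α → β) : ℕ → Prop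
  | 0 => PolyTimeComputable ∅ ea eb f
  | k + 1 => ∃ O : Set Word, InSigma k O ∧ PolyTimeComputable O ea eb f

/-- The property `p` of objects encoded by `ea` can be decided in `Δᵖₖ`. -/
def DecidableInDelta {α : Type*} (ea : α → Word) (p : α → Prop) (k : ℕ) : Prop :=
  ∃ f : α → Bool, (∀ a, f a = true ↔ p a) ∧ ComputableInDelta ea (fun b => [b]) f k

end PH

/-! ### Conjunctive queries with comparisons -/

namespace CQC

open PH

/-- Terms: constants from `D`, or variables; the names of variables are words. -/
inductive Term (D : Type*) : Type _
  | const (c : D) : Term D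
  | var (x : Word) : Term D

/-- An atom `R(z₁, …, zₙ)`. A relation symbol is a name (a word) together with its arity, so the
name `rel` with `n` arguments stands for the symbol `rel / n`. -/
structure Atom (D : Type*) where
  rel : Word
  args : List (Term D)

inductive Op : Type
  | eq | lt | le

/-- A comparison `lhs op rhs`. -/
structure Comparison (D : Type*) where
  lhs : Term D
  op : Op
  rhs : Term D

/-- A conjunctive query with comparisons: the summary row of distinguished variables, and the finite
sets of relational conjuncts and of comparisons (as lists, whose order and repetitions
are irrelevant). The variables that are not in the summary are existentially quantified. -/
structure Query (D : Type*) where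
  summary : List Word
  atoms : List (Atom D)
  comps : List (Comparison D)

variable {D : Type*}

/-- The terms that occur in a query. -/
def Query.adom (q : Query D) : Set (Term D) :=
  {t | (∃ x ∈ q.summary, t = Term.var x) ∨ (∃ a ∈ q.atoms, t ∈ a.args) ∨
    (∃ c ∈ q.comps, t = c.lhs ∨ t = c.rhs)}

/-- `r op s` holds in the total preorder `L` (where `L r s` means that `r` is at most `s`). -/
def Holds (L : Term D → Term D → Prop) (r : Term D) : Op → Term D → Prop
  | Op.eq, s => L r s ∧ L s r
  | Op.lt, s => L r s ∧ ¬ L s r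
  | Op.le, s => L r s

/-- `L` is a linearization of the comparisons of `q`: an arrangement of the terms of `q` in a linear
order, possibly with ties (a total preorder), that has the constants in their given order and
satisfies all comparisons. -/
structure IsLinearization [LinearOrder D] (q : Query D) (L : Term D → Term D → Prop) : Prop where
  total : ∀ r ∈ q.adom, ∀ s ∈ q.adom, L r s ∨ L s r
  trans : ∀ r ∈ q.adom, ∀ s ∈ q.adom, ∀ t ∈ q.adom, L r s → L s t → L r t
  const : ∀ c d : D, Term.const c ∈ q.adom → Term.const d ∈ q.adom →
    (L (Term.const c) (Term.const d) ↔ c ≤ d)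
  comps : ∀ c ∈ q.comps, Holds L c.lhs c.op c.rhs

/-- The comparisons of `q` entail `r op s` (used for terms `r`, `s` of `q`). -/
def Entails [LinearOrder D] (q : Query D) (r : Term D) (op : Op) (s : Term D) : Prop :=
  ∀ L : Term D → Term D → Prop, IsLinearization q L → Holds L r op s

/-- `h` is a homomorphism from `q₁` to `q₂` over the common summary: a map from the terms of `q₁` to
those of `q₂` that is the identity on the distinguished variables and on the constants, maps atoms
to atoms, and maps comparisons to comparisons that hold in all linearizations.
(The values of `h` outside `q₁.adom` are irrelevant.) -/
structure IsHom [LinearOrder D] (q₁ q₂ : Query D) (h : Term D → Term D) : Prop where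
  summary_eq : q₁.summary = q₂.summary
  mapsTo : Set.MapsTo h q₁.adom q₂.adom
  summary : ∀ x ∈ q₁.summary, h (Term.var x) = Term.var x
  const : ∀ c : D, Term.const c ∈ q₁.adom → h (Term.const c) = Term.const c
  atoms : ∀ a ∈ q₁.atoms, (⟨a.rel, a.args.map h⟩ : Atom D) ∈ q₂.atoms
  comps : ∀ c ∈ q₁.comps, Entails q₂ (h c.lhs) c.op (h c.rhs)

def HomTo [LinearOrder D] (q₁ q₂ : Query D) : Prop := ∃ h, IsHom q₁ q₂ h

/-- `q'` is the extension of `q`: the query with all entailed comparisons between terms of `q`. -/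
structure IsExtension [LinearOrder D] (q' q : Query D) : Prop where
  summary : q'.summary = q.summary
  atoms : ∀ a, a ∈ q'.atoms ↔ a ∈ q.atoms
  comps : ∀ c : Comparison D, c ∈ q'.comps ↔
    c.lhs ∈ q.adom ∧ c.rhs ∈ q.adom ∧ Entails q c.lhs c.op c.rhs

/-- `q'` is a core of `q`. -/
structure IsCore [LinearOrder D] (q q' : Query D) : Prop where
  hom : HomTo q q'
  injective : ∀ q'' : Query D, HomTo q q'' → HomTo q'' q →
    ∃ h, IsHom q' q'' h ∧ Set.InjOn h q'.adom
  extended : IsExtension q' q'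

/-- `q₁` and `q₂` are isomorphic over their common summary: there is a bijection between
their terms, the identity on distinguished variables and on constants, that preserves and
reflects atoms and comparisons. -/
def Isomorphic (q₁ q₂ : Query D) : Prop :=
  q₁.summary = q₂.summary ∧ ∃ h : Term D → Term D, Set.BijOn h q₁.adom q₂.adom ∧
    (∀ x ∈ q₁.summary, h (Term.var x) = Term.var x) ∧
    (∀ c : D, Term.const c ∈ q₁.adom → h (Term.const c) = Term.const c) ∧
    (∀ R : Word, ∀ z : List (Term D), (∀ t ∈ z, t ∈ q₁.adom) →
      ((⟨R, z⟩ : Atom D) ∈ q₁.atoms ↔ (⟨R, z.map h⟩ : Atom D) ∈ q₂.atoms)) ∧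
    (∀ r ∈ q₁.adom, ∀ s ∈ q₁.adom, ∀ op : Op,
      ((⟨r, op, s⟩ : Comparison D) ∈ q₁.comps ↔ (⟨h r, op, h s⟩ : Comparison D) ∈ q₂.comps))

/-! Encodings, with respect to a representation `code` of the constants by words. -/

def encTerm (code : D → Word) : Term D → Word
  | Term.const c => false :: code c
  | Term.var x => true :: x

def encAtom (code : D → Word) (a : Atom D) : Word :=
  tuple (a.rel :: a.args.map (encTerm code))

def encOp : Op → Word
  | Op.eq => [false, false]
  | Op.lt => [false, true]
  | Op.le => [true, false]

def encComparison (code : D → Word) (c : Comparison D) : Word :=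
  tuple [encOp c.op, encTerm code c.lhs, encTerm code c.rhs]

def encQuery (code : D → Word) (q : Query D) : Word :=
  tuple [tuple q.summary, tuple (q.atoms.map (encAtom code)),
    tuple (q.comps.map (encComparison code))]

def encQueryPair (code : D → Word) (p : Query D × Query D) : Word :=
  tuple [encQuery code p.1, encQuery code p.2]

end CQC

/-!
Homomorphisms between queries compose, since a linearization can be pulled back along a homomorphism
(`CQC.IsHom.isLinearization`). Hence an endomorphism of `q` with the least possible number of values
induces a core: the query on its image with all atoms of `q` there and all comparisons that `q`
entails (`CQC.isCore_induced`, `CQC.exists_isHom_injOn_image`). What makes it a core is that every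
endomorphism of `q` is injective on the image. Cores of the same query are isomorphic, because there
are injective homomorphisms in both directions between two of them (`CQC.IsCore.isomorphic`).

Such an induced core is certified by the endomorphism together with a list of linearizations, one
for every comparison that is not entailed; so a comparison is entailed if it holds in all of them.
That the list consists of linearizations and that the given map is an endomorphism can be checked
in polynomial time. What remains is universally quantified: every linearization satisfies what holds
in the whole list, and every endomorphism is injective on the image. Hence the set of all words that
can be extended to the encoding of an induced core is in `Σᵖ₂` (`CQC.exists_core_oracle`), and a
core can be found bit by bit with this oracle (`PH.exists_search`). By the uniqueness of cores, the
computed cores of two queries are isomorphic if and only if some two induced cores are, which is a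
single question to an oracle in `Σᵖ₂` (`CQC.exists_iso_oracle`). Equivalence of the queries would not
be the right question: `CQC.Isomorphic` admits that a variable is mapped to a constant that does not
occur in the first query.

To see that the checks take polynomial time, a small calculus of polynomial-time functions on words
is developed for the given machine model (`PH.PolyFun`, `PH.PolyDec`): it contains some basic
operations and is closed under composition, case distinction, and concatenation of the values of a
function over a sequence of words (`PH.PolyFun.flatMap`). This yields bounded quantifiers over the
members of a sequence, which is all that the checks need. Linearizations are represented by
functions from terms to words, compared by length, so that totality and transitivity are automatic.
-/

namespace PH

/-! ### Running programs on finitely many stacks -/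

/-- `Runs O P s s' T`: started on `s`, the program `P` halts on `s'` after at most `T` steps. -/
def Runs (O : Set Word) (P : Prog) (s s' : Store) (T : ℕ) : Prop :=
  ∃ t ≤ T, Exec O P s s' t

/-- The store with the words of `l` on the stacks `0, 1, …`, all other stacks being empty. -/
def put (l : List Word) : Store := fun r => l.getD r []

/-- The program `P` with all its stacks moved up by `k`. -/
def Prog.shift (k : ℕ) : Prog → Prog
  | skip => skip
  | push r b => push (k + r) b
  | pop r => pop (k + r)
  | seq P Q => seq (P.shift k) (Q.shift k)
  | branch r P Q R => branch (k + r) (P.shift k) (Q.shift k) (R.shift k)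
  | loop r P => loop (k + r) (P.shift k)
  | ask r => ask (k + r)

/-- A bound (exclusive) for the stacks that are mentioned in a program. -/
def Prog.width : Prog → ℕ
  | skip => 0
  | push r _ => r + 1
  | pop r => r + 1
  | seq P Q => max P.width Q.width
  | branch r P Q R => max (r + 1) (max P.width (max Q.width R.width))
  | loop r P => max (r + 1) P.width
  | ask r => r + 1

variable {O : Set Word}

theorem initial_eq_put (w : Word) : initial w = put [w] := by
  funext r
  rcases r with _ | r <;> simp [initial, put, Function.update]

theorem put_append_replicate (l : List Word) (n : ℕ) : put (l ++ List.replicate n []) = put l := by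
  funext r
  simp only [put, List.getD_eq_getElem?_getD, List.getElem?_append]
  split_ifs with h
  · rfl
  · rw [List.getElem?_replicate]
    split_ifs <;> simp [List.getElem?_eq_none (not_lt.mp h)]

theorem put_pad {l : List Word} (n : ℕ) {l' : List Word} (h : l ++ List.replicate n [] = l') :
    put l = put l' := by
  rw [← h, put_append_replicate]

theorem put_apply (l : List Word) (i : ℕ) : put l i = l.getD i [] := rfl

theorem update_put {l : List Word} {i : ℕ} (h : i < l.length) (w : Word) :
    Function.update (put l) i w = put (l.set i w) := by
  funext r
  by_cases hr : r = i
  · subst hr; simp [put, h]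
  · simp [put, Function.update_of_ne hr, List.getElem?_set_ne (Ne.symm hr)]

namespace Runs

theorem mono {P : Prog} {s s' : Store} {T T' : ℕ} (h : Runs O P s s' T) (hT : T ≤ T') :
    Runs O P s s' T' := by
  obtain ⟨t, ht, h⟩ := h
  exact ⟨t, ht.trans hT, h⟩

theorem skip (s : Store) : Runs O Prog.skip s s 1 := ⟨1, le_rfl, Exec.skip s⟩

theorem seq {P Q : Prog} {s s' s'' : Store} {m n : ℕ} (h : Runs O P s s' m)
    (h' : Runs O Q s' s'' n) : Runs O (Prog.seq P Q) s s'' (m + n) := by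
  obtain ⟨t, ht, h⟩ := h
  obtain ⟨t', ht', h'⟩ := h'
  exact ⟨t + t', by omega, Exec.seq h h'⟩

theorem push {l : List Word} {i : ℕ} (hi : i < l.length) (b : Bool) :
    Runs O (Prog.push i b) (put l) (put (l.set i (b :: l.getD i []))) 1 := by
  rw [← update_put hi]
  exact ⟨1, le_rfl, Exec.push i b (put l)⟩

theorem pop {l : List Word} {i : ℕ} (hi : i < l.length) :
    Runs O (Prog.pop i) (put l) (put (l.set i (l.getD i []).tail)) 1 := by
  rw [← update_put hi]
  exact ⟨1, le_rfl, Exec.pop i (put l)⟩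

theorem branchEmpty {s s' : Store} {i : ℕ} {P Q R : Prog} {T : ℕ} (hi : s i = [])
    (h : Runs O P s s' T) : Runs O (Prog.branch i P Q R) s s' (T + 1) := by
  obtain ⟨t, ht, h⟩ := h
  exact ⟨t + 1, by omega, Exec.branchEmpty hi h⟩

theorem branchFalse {s s' : Store} {i : ℕ} {P Q R : Prog} {T : ℕ} {w : Word}
    (hi : s i = false :: w) (h : Runs O Q s s' T) :
    Runs O (Prog.branch i P Q R) s s' (T + 1) := by
  obtain ⟨t, ht, h⟩ := h
  exact ⟨t + 1, by omega, Exec.branchFalse hi h⟩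

theorem branchTrue {s s' : Store} {i : ℕ} {P Q R : Prog} {T : ℕ} {w : Word}
    (hi : s i = true :: w) (h : Runs O R s s' T) :
    Runs O (Prog.branch i P Q R) s s' (T + 1) := by
  obtain ⟨t, ht, h⟩ := h
  exact ⟨t + 1, by omega, Exec.branchTrue hi h⟩

theorem loopDone {s : Store} {i : ℕ} {P : Prog} (hi : s i = []) :
    Runs O (Prog.loop i P) s s 1 := ⟨1, le_rfl, Exec.loopDone hi⟩

theorem loopStep {s s' s'' : Store} {i : ℕ} {P : Prog} {m n : ℕ} (hi : s i ≠ [])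
    (h : Runs O P s s' m) (h' : Runs O (Prog.loop i P) s' s'' n) :
    Runs O (Prog.loop i P) s s'' (m + n + 1) := by
  obtain ⟨t, ht, h⟩ := h
  obtain ⟨t', ht', h'⟩ := h'
  exact ⟨t + t' + 1, by omega, Exec.loopStep hi h h'⟩

end Runs

/-- The store `s` moved up by `k` stacks, with the first `k` stacks of `s₀` below it. -/
def above (k : ℕ) (s₀ s : Store) : Store := fun r => if r < k then s₀ r else s (r - k)

theorem above_add (k : ℕ) (s₀ s : Store) (r : ℕ) : above k s₀ s (k + r) = s r := by
  simp [above]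

theorem above_update (k : ℕ) (s₀ s : Store) (r : ℕ) (w : Word) :
    above k s₀ (Function.update s r w) = Function.update (above k s₀ s) (k + r) w := by
  funext i
  by_cases hi : i = k + r
  · subst hi; simp [above]
  · rw [Function.update_of_ne hi]
    simp only [above]
    split_ifs with h
    · rfl
    · rw [Function.update_of_ne (by omega)]

theorem Exec.shift {P : Prog} {s s' : Store} {t : ℕ} (h : Exec O P s s' t) (k : ℕ) (s₀ : Store) :
    Exec O (P.shift k) (above k s₀ s) (above k s₀ s') t := by
  induction h with
  | skip s => exact Exec.skip _
  | push r b s =>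
    have := Exec.push (O := O) (k + r) b (above k s₀ s)
    rwa [above_add, ← above_update] at this
  | pop r s =>
    have := Exec.pop (O := O) (k + r) (above k s₀ s)
    rwa [above_add, ← above_update] at this
  | seq _ _ ih ih' => exact Exec.seq ih ih'
  | branchEmpty hr _ ih => exact Exec.branchEmpty (by rwa [above_add]) ih
  | branchFalse hr _ ih => exact Exec.branchFalse (by rwa [above_add]) ih
  | branchTrue hr _ ih => exact Exec.branchTrue (by rwa [above_add]) ih
  | loopDone hr => exact Exec.loopDone (by rwa [above_add])
  | loopStep hr _ _ ih ih' => exact Exec.loopStep (by rwa [above_add]) ih ih'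
  | @askYes r s hr =>
    rw [above_update]
    exact Exec.askYes (by rwa [above_add])
  | @askNo r s hr =>
    rw [above_update]
    exact Exec.askNo (by rwa [above_add])

theorem above_put (l₀ l : List Word) : above l₀.length (put l₀) (put l) = put (l₀ ++ l) := by
  funext r
  simp only [above, put, List.getD_eq_getElem?_getD, List.getElem?_append]
  split_ifs <;> rfl

/-- A program on its own stacks leaves the stacks below them alone. -/
theorem Runs.shift {P : Prog} {l l' : List Word} {T : ℕ} (h : Runs O P (put l) (put l') T)
    {k : ℕ} (l₀ : List Word) (hk : l₀.length = k) :
    Runs O (P.shift k) (put (l₀ ++ l)) (put (l₀ ++ l')) T := by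
  obtain ⟨t, ht, h⟩ := h
  subst hk
  refine ⟨t, ht, ?_⟩
  rw [← above_put, ← above_put]
  exact h.shift _ _

theorem Exec.length_le {P : Prog} {s s' : Store} {t : ℕ} (h : Exec O P s s' t) (r : ℕ) :
    (s' r).length ≤ (s r).length + t := by
  induction h with
  | skip s => omega
  | push i b s => by_cases hr : r = i <;> [subst hr; skip] <;> simp [Function.update, *]
  | pop i s =>
    by_cases hr : r = i <;> [subst hr; skip] <;> simp [Function.update, *]; omega
  | seq _ _ ih ih' => omega
  | branchEmpty _ _ ih => omega
  | branchFalse _ _ ih => omega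
  | branchTrue _ _ ih => omega
  | loopDone _ => omega
  | loopStep _ _ _ ih ih' => omega
  | @askYes i s hi => by_cases hr : r = i <;> [subst hr; skip] <;> simp [Function.update, *]
  | @askNo i s hi => by_cases hr : r = i <;> [subst hr; skip] <;> simp [Function.update, *]

theorem Exec.eq_of_width_le {P : Prog} {s s' : Store} {t : ℕ} (h : Exec O P s s' t) (r : ℕ)
    (hr : P.width ≤ r) : s' r = s r := by
  induction h with
  | skip s => rfl
  | push i b s => exact Function.update_of_ne (by simp [Prog.width] at hr; omega) _ _
  | pop i s => exact Function.update_of_ne (by simp [Prog.width] at hr; omega) _ _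
  | seq _ _ ih ih' =>
    simp [Prog.width] at hr
    rw [ih' hr.2, ih hr.1]
  | branchEmpty _ _ ih => simp [Prog.width] at hr; exact ih (by omega)
  | branchFalse _ _ ih => simp [Prog.width] at hr; exact ih (by omega)
  | branchTrue _ _ ih => simp [Prog.width] at hr; exact ih (by omega)
  | loopDone _ => rfl
  | loopStep _ _ _ ih ih' =>
    rw [ih' hr]
    simp [Prog.width] at hr
    exact ih hr.2
  | askYes _ => exact Function.update_of_ne (by simp [Prog.width] at hr; omega) _ _
  | askNo _ => exact Function.update_of_ne (by simp [Prog.width] at hr; omega) _ _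

/-! ### Moving words between stacks -/

/-- Move stack `i` to stack `j`, which reverses it. -/
def moveRev (i j : ℕ) : Prog :=
  Prog.loop i (Prog.branch i Prog.skip (Prog.seq (Prog.pop i) (Prog.push j false))
    (Prog.seq (Prog.pop i) (Prog.push j true)))

/-- Move stack `i` to both stack `j` and stack `k`, which reverses it. -/
def moveRev₂ (i j k : ℕ) : Prog :=
  Prog.loop i (Prog.branch i Prog.skip
    (Prog.seq (Prog.pop i) (Prog.seq (Prog.push j false) (Prog.push k false)))
    (Prog.seq (Prog.pop i) (Prog.seq (Prog.push j true) (Prog.push k true))))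

/-- Push the block of the reversed content of stack `i` onto stack `j`. -/
def emit (i j : ℕ) : Prog :=
  Prog.seq (Prog.push j false) (Prog.loop i (Prog.branch i Prog.skip
    (Prog.seq (Prog.pop i) (Prog.seq (Prog.push j false) (Prog.push j true)))
    (Prog.seq (Prog.pop i) (Prog.seq (Prog.push j true) (Prog.push j true)))))

/-- Empty stack `i`. -/
def clear (i : ℕ) : Prog := Prog.loop i (Prog.pop i)

theorem runs_moveRev {i j : ℕ} {l : List Word} (hij : i ≠ j) (hi : i < l.length)
    (hj : j < l.length) :
    Runs O (moveRev i j) (put l)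
      (put ((l.set i []).set j ((l.getD i []).reverse ++ l.getD j [])))
      (4 * (l.getD i []).length + 1) := by
  generalize hw : l.getD i [] = w
  induction w generalizing l with
  | nil =>
    have h1 : l.set i [] = l := by
      rw [← hw]; simp [hi]
    have h2 : l.set j (l.getD j []) = l := by simp [hj]
    rw [h1, List.reverse_nil, List.nil_append, h2]
    exact Runs.loopDone hw
  | cons b w ih =>
    have key := @ih ((l.set i w).set j (b :: l.getD j [])) (by simpa) (by simpa)
      (by simp [List.getElem_set_ne hij.symm, hi])
    have e : ((((l.set i w).set j (b :: l.getD j [])).set i []).set j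
        (w.reverse ++ ((l.set i w).set j (b :: l.getD j [])).getD j [])) =
        ((l.set i []).set j ((b :: w).reverse ++ l.getD j [])) := by
      rw [List.set_comm _ _ hij.symm]
      simp [hj]
    rw [e] at key
    have step : ∀ b', b = b' → Runs O (Prog.seq (Prog.pop i) (Prog.push j b')) (put l)
        (put ((l.set i w).set j (b :: l.getD j []))) 2 := by
      rintro _ rfl
      refine Runs.seq (m := 1) (n := 1) (Runs.pop hi) ?_
      rw [hw]
      have := Runs.push (O := O) (l := l.set i w) (i := j) (by simpa) b
      simpa [List.getElem?_set_ne hij] using this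
    refine (Runs.loopStep (m := 3) (by rw [put_apply, hw]; simp) ?_ key).mono
      (by simp; omega)
    cases b with
    | false => exact Runs.branchFalse hw (step _ rfl)
    | true => exact Runs.branchTrue hw (step _ rfl)

theorem runs_moveRev₂ {i j k : ℕ} {l : List Word} (hij : i ≠ j) (hik : i ≠ k) (hjk : j ≠ k)
    (hi : i < l.length) (hj : j < l.length) (hk : k < l.length) :
    Runs O (moveRev₂ i j k) (put l)
      (put (((l.set i []).set j ((l.getD i []).reverse ++ l.getD j [])).set k
        ((l.getD i []).reverse ++ l.getD k [])))
      (5 * (l.getD i []).length + 1) := by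
  generalize hw : l.getD i [] = w
  induction w generalizing l with
  | nil =>
    have h1 : l.set i [] = l := by
      rw [← hw]; simp [hi]
    have h2 : l.set j (l.getD j []) = l := by simp [hj]
    have h3 : l.set k (l.getD k []) = l := by simp [hk]
    rw [h1, List.reverse_nil, List.nil_append, List.nil_append, h2, h3]
    exact Runs.loopDone hw
  | cons b w ih =>
    have key := @ih (((l.set i w).set j (b :: l.getD j [])).set k (b :: l.getD k []))
      (by simpa) (by simpa) (by simpa)
      (by simp [List.getElem_set_ne hij.symm, List.getElem_set_ne hik.symm, hi])
    have e : ((((((l.set i w).set j (b :: l.getD j [])).set k (b :: l.getD k [])).set i []).set j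
        (w.reverse ++ (((l.set i w).set j (b :: l.getD j [])).set k
          (b :: l.getD k [])).getD j [])).set k
        (w.reverse ++ (((l.set i w).set j (b :: l.getD j [])).set k
          (b :: l.getD k [])).getD k [])) =
        (((l.set i []).set j ((b :: w).reverse ++ l.getD j [])).set k
          ((b :: w).reverse ++ l.getD k [])) := by
      rw [List.set_comm _ _ hik.symm, List.set_comm _ _ hij.symm, List.set_comm _ _ hjk.symm]
      simp [hj, hk, List.getElem_set_ne hjk.symm]
    rw [e] at key
    have step : ∀ b', b = b' →
        Runs O (Prog.seq (Prog.pop i) (Prog.seq (Prog.push j b') (Prog.push k b'))) (put l)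
        (put (((l.set i w).set j (b :: l.getD j [])).set k (b :: l.getD k []))) 3 := by
      rintro _ rfl
      refine Runs.seq (m := 1) (n := 2) (Runs.pop hi) ?_
      rw [hw]
      refine Runs.seq (m := 1) (n := 1) (Runs.push (by simpa) b) ?_
      have := Runs.push (O := O) (l := (l.set i w).set j (b :: l.getD j [])) (i := k)
        (by simpa) b
      simpa [List.getElem?_set_ne hij, List.getElem?_set_ne hik,
        List.getElem?_set_ne hjk] using this
    refine (Runs.loopStep (m := 4) (by rw [put_apply, hw]; simp) ?_ key).mono
      (by simp; omega)
    cases b with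
    | false => exact Runs.branchFalse hw (step _ rfl)
    | true => exact Runs.branchTrue hw (step _ rfl)

theorem runs_emit {i j : ℕ} {l : List Word} (hij : i ≠ j) (hi : i < l.length)
    (hj : j < l.length) :
    Runs O (emit i j) (put l)
      (put ((l.set i []).set j (block (l.getD i []).reverse ++ l.getD j [])))
      (5 * (l.getD i []).length + 2) := by
  have main : ∀ (w : Word) (l : List Word), i < l.length → j < l.length → l.getD i [] = w →
      Runs O (Prog.loop i (Prog.branch i Prog.skip
        (Prog.seq (Prog.pop i) (Prog.seq (Prog.push j false) (Prog.push j true)))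
        (Prog.seq (Prog.pop i) (Prog.seq (Prog.push j true) (Prog.push j true))))) (put l)
        (put ((l.set i []).set j (w.reverse.flatMap (fun b => [true, b]) ++ l.getD j [])))
        (5 * w.length + 1) := by
    intro w
    induction w with
    | nil =>
      intro l hi hj hw
      have h1 : l.set i [] = l := by
        rw [← hw]; simp [hi]
      have h2 : l.set j (l.getD j []) = l := by simp [hj]
      rw [h1, List.reverse_nil, List.flatMap_nil, List.nil_append, h2]
      exact Runs.loopDone hw
    | cons b w ih =>
      intro l hi hj hw
      have key := @ih ((l.set i w).set j (true :: b :: l.getD j [])) (by simpa) (by simpa)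
        (by simp [List.getElem_set_ne hij.symm, hi])
      have e : ((((l.set i w).set j (true :: b :: l.getD j [])).set i []).set j
          (w.reverse.flatMap (fun b => [true, b]) ++
            ((l.set i w).set j (true :: b :: l.getD j [])).getD j [])) =
          ((l.set i []).set j ((b :: w).reverse.flatMap (fun b => [true, b]) ++
            l.getD j [])) := by
        rw [List.set_comm _ _ hij.symm]
        simp [hj]
      rw [e] at key
      have step : ∀ b', b = b' →
          Runs O (Prog.seq (Prog.pop i) (Prog.seq (Prog.push j b') (Prog.push j true))) (put l)
          (put ((l.set i w).set j (true :: b :: l.getD j []))) 3 := by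
        rintro _ rfl
        refine Runs.seq (m := 1) (n := 2) (Runs.pop hi) ?_
        rw [hw]
        refine Runs.seq (m := 1) (n := 1) (Runs.push (by simpa) b) ?_
        have := Runs.push (O := O) (l := (l.set i w).set j (b :: l.getD j [])) (i := j)
          (by simpa) true
        simpa [List.getElem_set_ne hij, hj] using this
      refine (Runs.loopStep (m := 4) (by rw [put_apply, hw]; simp) ?_ key).mono
        (by simp; omega)
      cases b with
      | false => exact Runs.branchFalse hw (step _ rfl)
      | true => exact Runs.branchTrue hw (step _ rfl)
  have := (Runs.push (O := O) hj false).seq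
    (main (l.getD i []) (l.set j (false :: l.getD j [])) (by simpa) (by simpa)
      (by simp [List.getElem?_set_ne hij.symm]))
  refine Eq.mp ?_ (this.mono (T' := 5 * (l.getD i []).length + 2) (by omega))
  congr 2
  rw [List.set_comm _ _ hij.symm]
  simp [block, hj]

theorem runs_clear {i : ℕ} {l : List Word} (hi : i < l.length) :
    Runs O (clear i) (put l) (put (l.set i [])) (2 * (l.getD i []).length + 1) := by
  generalize hw : l.getD i [] = w
  induction w generalizing l with
  | nil =>
    have h1 : l.set i [] = l := by
      rw [← hw]; simp [hi]
    rw [h1]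
    exact Runs.loopDone hw
  | cons b w ih =>
    have key := @ih (l.set i w) (by simpa) (by simp [hi])
    rw [List.set_set] at key
    refine (Runs.loopStep (m := 1) (by rw [put_apply, hw]; simp) ?_ key).mono
      (by simp; omega)
    have := Runs.pop (O := O) hi
    rwa [hw] at this

/-! ### Reading sequences of words -/

/-- The content of the first block of a word. -/
def hd : Word → Word
  | [] => []
  | false :: _ => []
  | [true] => []
  | true :: b :: r => b :: hd r

/-- What follows the first block of a word. -/
def tl : Word → Word
  | [] => []
  | false :: r => r
  | [true] => []
  | true :: _ :: r => tl r

theorem length_tl_le : ∀ w : Word, (tl w).length ≤ w.length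
  | [] => le_rfl
  | false :: r => by simp [tl]
  | [true] => by simp [tl]
  | true :: b :: r => by simp only [tl, List.length_cons]; have := length_tl_le r; omega

theorem length_tl_lt {w : Word} (h : w ≠ []) : (tl w).length < w.length := by
  match w, h with
  | false :: r, _ => simp [tl]
  | [true], _ => simp [tl]
  | true :: b :: r, _ => simp only [tl, List.length_cons]; have := length_tl_le r; omega

theorem length_hd_le : ∀ w : Word, (hd w).length ≤ w.length
  | [] => le_rfl
  | false :: r => by simp [hd]
  | [true] => by simp [hd]
  | true :: b :: r => by simp only [hd, List.length_cons]; have := length_hd_le r; omega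

/-- The sequence of words that a word encodes. Every word is read as a sequence; an incomplete last
block is completed. -/
def untuple (w : Word) : List Word :=
  if _h : w = [] then [] else hd w :: untuple (tl w)
termination_by w.length
decreasing_by exact length_tl_lt _h

theorem untuple_nil : untuple [] = [] := by rw [untuple]; simp

theorem untuple_of_ne {w : Word} (h : w ≠ []) : untuple w = hd w :: untuple (tl w) := by
  rw [untuple]; simp [h]

theorem block_cons (b : Bool) (u : Word) : block (b :: u) = true :: b :: block u := rfl

theorem block_ne_nil (u : Word) : block u ≠ [] := by simp [block]

@[simp] theorem hd_block_append (u w : Word) : hd (block u ++ w) = u := by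
  induction u with
  | nil => rfl
  | cons b u ih => simp [block_cons, hd, ih]

@[simp] theorem tl_block_append (u w : Word) : tl (block u ++ w) = w := by
  induction u with
  | nil => rfl
  | cons b u ih => simp [block_cons, tl, ih]

theorem tuple_nil : tuple [] = [] := rfl

theorem tuple_cons (u : Word) (l : List Word) : tuple (u :: l) = block u ++ tuple l := rfl

@[simp] theorem hd_tuple_cons (u : Word) (l : List Word) : hd (tuple (u :: l)) = u :=
  hd_block_append _ _

@[simp] theorem tl_tuple_cons (u : Word) (l : List Word) : tl (tuple (u :: l)) = tuple l :=
  tl_block_append _ _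

@[simp] theorem untuple_tuple (l : List Word) : untuple (tuple l) = l := by
  induction l with
  | nil => exact untuple_nil
  | cons u l ih =>
    rw [untuple_of_ne (by simp [tuple_cons, block_ne_nil])]
    simp [ih]

theorem length_block (u : Word) : (block u).length = 2 * u.length + 1 := by
  induction u with
  | nil => rfl
  | cons b u ih => rw [block_cons]; simp [ih]; omega

/-! ### Functions on words that are computable in polynomial time -/

/-- `f` is computed in polynomial time by a program that cleans up after itself. -/
def PolyFun (O : Set Word) (f : Word → Word) : Prop :=
  ∃ (P : Prog) (p : Polynomial ℕ), ∀ w, Runs O P (put [w]) (put [f w]) (p.eval w.length)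

/-- The binary operation `op` on the words of the first two stacks is computed in polynomial time
by a program that cleans up after itself. -/
def PolyOp (O : Set Word) (op : Word → Word → Word) : Prop :=
  ∃ (P : Prog) (p : Polynomial ℕ), ∀ a b,
    Runs O P (put [a, b]) (put [op a b]) (p.eval (a.length + b.length))

theorem eval_mono (p : Polynomial ℕ) {m n : ℕ} (h : m ≤ n) : p.eval m ≤ p.eval n := by
  rw [Polynomial.eval_eq_sum, Polynomial.eval_eq_sum]
  exact Finset.sum_le_sum fun i _ => Nat.mul_le_mul le_rfl (Nat.pow_le_pow_left h i)

theorem Runs.length_le {P : Prog} {l l' : List Word} {T : ℕ} (h : Runs O P (put l) (put l') T)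
    (i : ℕ) : (l'.getD i []).length ≤ (l.getD i []).length + T := by
  obtain ⟨t, ht, h⟩ := h
  have := h.length_le i
  simp only [put_apply] at this
  omega

namespace PolyFun

theorem id : PolyFun O (fun w => w) :=
  ⟨Prog.skip, 1, fun w => (Runs.skip _).mono (by simp)⟩

theorem comp {f g : Word → Word} (hf : PolyFun O f) (hg : PolyFun O g) :
    PolyFun O (fun w => f (g w)) := by
  obtain ⟨P, p, hP⟩ := hf
  obtain ⟨Q, q, hQ⟩ := hg
  refine ⟨Prog.seq Q P, q + p.comp (Polynomial.X + q), fun w =>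
    ((hQ w).seq (hP _)).mono ?_⟩
  have := (hQ w).length_le 0
  simp only [List.getD_cons_zero] at this
  have := eval_mono p this
  simpa using this

/-- Push the word `v` onto stack `0`. -/
def pushAll : Word → Prog
  | [] => Prog.skip
  | b :: v => Prog.seq (pushAll v) (Prog.push 0 b)

theorem runs_pushAll (v : Word) :
    Runs O (pushAll v) (put [[]]) (put [v]) (v.length + 1) := by
  induction v with
  | nil => exact Runs.skip _
  | cons b v ih =>
    exact ih.seq (Runs.push (i := 0) (l := [v]) (by simp) b)

theorem const (v : Word) : PolyFun O (fun _ => v) := by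
  refine ⟨Prog.seq (clear 0) (pushAll v), 2 * Polynomial.X + Polynomial.C (v.length + 2),
    fun w => ?_⟩
  refine ((runs_clear (i := 0) (l := [w]) (by simp)).seq (runs_pushAll v)).mono ?_
  simp; omega

theorem tail : PolyFun O List.tail :=
  ⟨Prog.pop 0, 1, fun w => (Runs.pop (i := 0) (l := [w]) (by simp)).mono (by simp)⟩

theorem reverse : PolyFun O List.reverse := by
  refine ⟨Prog.seq (moveRev 0 1) (Prog.seq (moveRev 1 2) (moveRev 2 0)),
    12 * Polynomial.X + 3, fun w => ?_⟩
  have h1 : Runs O (moveRev 0 1) (put [w, [], []]) (put [[], w.reverse, []])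
      (4 * w.length + 1) := by
    simpa using runs_moveRev (O := O) (i := 0) (j := 1) (l := [w, [], []]) (by simp) (by simp)
      (by simp)
  have h2 : Runs O (moveRev 1 2) (put [[], w.reverse, []]) (put [[], [], w])
      (4 * w.length + 1) := by
    simpa using runs_moveRev (O := O) (i := 1) (j := 2) (l := [[], w.reverse, []]) (by simp)
      (by simp) (by simp)
  have h3 : Runs O (moveRev 2 0) (put [[], [], w]) (put [w.reverse, [], []])
      (4 * w.length + 1) := by
    simpa using runs_moveRev (O := O) (i := 2) (j := 0) (l := [[], [], w]) (by simp)
      (by simp) (by simp)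
  rw [put_pad 2 (l := [w]) rfl, put_pad 2 (l := [w.reverse]) rfl]
  refine (h1.seq (h2.seq h3)).mono ?_
  simp; omega

theorem block : PolyFun O block := by
  refine ⟨Prog.seq (moveRev 0 1) (emit 1 0), 9 * Polynomial.X + 3, fun w => ?_⟩
  have h1 : Runs O (moveRev 0 1) (put [w, []]) (put [[], w.reverse])
      (4 * w.length + 1) := by
    simpa using runs_moveRev (O := O) (i := 0) (j := 1) (l := [w, []]) (by simp) (by simp)
      (by simp)
  have h2 : Runs O (emit 1 0) (put [[], w.reverse]) (put [PH.block w, []])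
      (5 * w.length + 2) := by
    simpa using runs_emit (O := O) (i := 1) (j := 0) (l := [[], w.reverse]) (by simp)
      (by simp) (by simp)
  rw [put_pad 1 (l := [w]) rfl, put_pad 1 (l := [PH.block w]) rfl]
  refine (h1.seq h2).mono ?_
  simp; omega

/-- Compute two functions of the same argument. -/
theorem two {f g : Word → Word} (hf : PolyFun O f) (hg : PolyFun O g) :
    ∃ (P : Prog) (p : Polynomial ℕ), ∀ w,
      Runs O P (put [w]) (put [f w, g w]) (p.eval w.length) := by
  obtain ⟨P, p, hP⟩ := hf
  obtain ⟨Q, q, hQ⟩ := hg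
  refine ⟨Prog.seq (moveRev₂ 0 1 2) (Prog.seq (moveRev 1 0) (Prog.seq (moveRev 2 1)
    (Prog.seq (P.shift 1) (Prog.seq (moveRev 0 2) (Prog.seq (moveRev 1 3)
    (Prog.seq (moveRev 2 1) (Prog.seq (moveRev 3 0) (Q.shift 1)))))))),
    29 * Polynomial.X + 8 + 9 * p + q, fun w => ?_⟩
  have h1 : Runs O (moveRev₂ 0 1 2) (put [w, [], [], []]) (put [[], w.reverse, w.reverse, []])
      (5 * w.length + 1) := by
    simpa using runs_moveRev₂ (O := O) (i := 0) (j := 1) (k := 2) (l := [w, [], [], []])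
      (by simp) (by simp) (by simp) (by simp) (by simp) (by simp)
  have h2 : Runs O (moveRev 1 0) (put [[], w.reverse, w.reverse, []])
      (put [w, [], w.reverse, []]) (4 * w.length + 1) := by
    simpa using runs_moveRev (O := O) (i := 1) (j := 0) (l := [[], w.reverse, w.reverse, []])
      (by simp) (by simp) (by simp)
  have h3 : Runs O (moveRev 2 1) (put [w, [], w.reverse, []])
      (put [w, w, [], []]) (4 * w.length + 1) := by
    simpa using runs_moveRev (O := O) (i := 2) (j := 1) (l := [w, [], w.reverse, []])
      (by simp) (by simp) (by simp)
  have h4 := (hP w).shift [w] (k := 1) rfl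
  rw [put_pad 2 (l := [w] ++ [w]) rfl, put_pad 2 (l := [w] ++ [f w]) rfl] at h4
  have h5 : Runs O (moveRev 0 2) (put [w, f w, [], []])
      (put [[], f w, w.reverse, []]) (4 * w.length + 1) := by
    simpa using runs_moveRev (O := O) (i := 0) (j := 2) (l := [w, f w, [], []])
      (by simp) (by simp) (by simp)
  have h6 : Runs O (moveRev 1 3) (put [[], f w, w.reverse, []])
      (put [[], [], w.reverse, (f w).reverse]) (4 * (f w).length + 1) := by
    simpa using runs_moveRev (O := O) (i := 1) (j := 3) (l := [[], f w, w.reverse, []])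
      (by simp) (by simp) (by simp)
  have h7 : Runs O (moveRev 2 1) (put [[], [], w.reverse, (f w).reverse])
      (put [[], w, [], (f w).reverse]) (4 * w.length + 1) := by
    simpa using runs_moveRev (O := O) (i := 2) (j := 1) (l := [[], [], w.reverse, (f w).reverse])
      (by simp) (by simp) (by simp)
  have h8 : Runs O (moveRev 3 0) (put [[], w, [], (f w).reverse])
      (put [f w, w, [], []]) (4 * (f w).length + 1) := by
    simpa using runs_moveRev (O := O) (i := 3) (j := 0) (l := [[], w, [], (f w).reverse])
      (by simp) (by simp) (by simp)
  have h9 := (hQ w).shift [f w] (k := 1) rfl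
  rw [put_pad 2 (l := [f w] ++ [w]) rfl] at h9
  rw [put_pad 3 (l := [w]) rfl]
  refine (h1.seq (h2.seq (h3.seq (h4.seq (h5.seq (h6.seq (h7.seq (h8.seq h9)))))))).mono ?_
  have := (hP w).length_le 0
  simp at this ⊢
  omega

end PolyFun

theorem PolyOp.comp {op : Word → Word → Word} (h : PolyOp O op) {f g : Word → Word}
    (hf : PolyFun O f) (hg : PolyFun O g) : PolyFun O (fun w => op (f w) (g w)) := by
  obtain ⟨P, p, hP⟩ := h
  obtain ⟨Q, q, hQ⟩ := hf.two hg
  refine ⟨Prog.seq Q P, q + p.comp (Polynomial.X + 2 * q), fun w =>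
    ((hQ w).seq (hP _ _)).mono ?_⟩
  have h0 := (hQ w).length_le 0
  have h1 := (hQ w).length_le 1
  simp at h0 h1
  have := eval_mono p (show (f w).length + (g w).length ≤ w.length + 2 * q.eval w.length by omega)
  simpa using this

theorem PolyOp.append : PolyOp O (fun a b => a ++ b) := by
  refine ⟨Prog.seq (moveRev 0 2) (Prog.seq (moveRev 1 3) (Prog.seq (moveRev 3 0)
    (moveRev 2 0))), 8 * Polynomial.X + 4, fun a b => ?_⟩
  have h1 : Runs O (moveRev 0 2) (put [a, b, [], []]) (put [[], b, a.reverse, []])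
      (4 * a.length + 1) := by
    simpa using runs_moveRev (O := O) (i := 0) (j := 2) (l := [a, b, [], []]) (by simp) (by simp)
      (by simp)
  have h2 : Runs O (moveRev 1 3) (put [[], b, a.reverse, []]) (put [[], [], a.reverse, b.reverse])
      (4 * b.length + 1) := by
    simpa using runs_moveRev (O := O) (i := 1) (j := 3) (l := [[], b, a.reverse, []]) (by simp)
      (by simp) (by simp)
  have h3 : Runs O (moveRev 3 0) (put [[], [], a.reverse, b.reverse]) (put [b, [], a.reverse, []])
      (4 * b.length + 1) := by
    simpa using runs_moveRev (O := O) (i := 3) (j := 0) (l := [[], [], a.reverse, b.reverse])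
      (by simp) (by simp) (by simp)
  have h4 : Runs O (moveRev 2 0) (put [b, [], a.reverse, []]) (put [a ++ b, [], [], []])
      (4 * a.length + 1) := by
    simpa using runs_moveRev (O := O) (i := 2) (j := 0) (l := [b, [], a.reverse, []])
      (by simp) (by simp) (by simp)
  rw [put_pad 2 (l := [a, b]) rfl, put_pad 3 (l := [a ++ b]) rfl]
  refine (h1.seq (h2.seq (h3.seq h4))).mono ?_
  simp; omega

theorem PolyFun.append {f g : Word → Word} (hf : PolyFun O f) (hg : PolyFun O g) :
    PolyFun O (fun w => f w ++ g w) := PolyOp.append.comp hf hg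

/-! ### Case distinctions, comparisons of words -/

/-- Case distinction on whether a word is empty. -/
theorem PolyFun.ite_nil {c f g : Word → Word} (hc : PolyFun O c) (hf : PolyFun O f)
    (hg : PolyFun O g) : PolyFun O (fun w => if c w = [] then f w else g w) := by
  obtain ⟨P, p, hP⟩ := hf
  obtain ⟨Q, q, hQ⟩ := hg
  obtain ⟨R, r, hR⟩ := PolyFun.id.two hc
  refine ⟨Prog.seq R (Prog.branch 1 P (Prog.seq (clear 1) Q) (Prog.seq (clear 1) Q)),
    3 * r + p + q + 2, fun w => ?_⟩
  have hl := (hR w).length_le 1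
  have h1 : Runs O (clear 1) (put [w, c w]) (put [w]) (2 * (c w).length + 1) := by
    rw [put_pad 1 (l := [w]) rfl]
    simpa using runs_clear (O := O) (i := 1) (l := [w, c w]) (by simp)
  refine ((hR w).seq (n := 2 * (c w).length + 2 + p.eval w.length + q.eval w.length) ?_).mono ?_
  · beta_reduce
    rcases hcw : c w with _ | ⟨b, u⟩
    · rw [if_pos rfl, ← put_pad 1 (l := [w]) (l' := [w, []]) rfl]
      exact (Runs.branchEmpty rfl (hP w)).mono (by omega)
    · rw [hcw] at h1
      have := h1.seq (hQ w)
      rw [if_neg (by simp)]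
      cases b with
      | false => exact (Runs.branchFalse rfl this).mono (by omega)
      | true => exact (Runs.branchTrue rfl this).mono (by omega)
  · simp at hl ⊢
    omega

open Classical in
theorem PolyOp.lengthLe :
    PolyOp O (fun a b => if a.length ≤ b.length then [true] else []) := by
  have main : ∀ a b c : Word, Runs O (Prog.loop 0 (Prog.seq (Prog.pop 0)
      (Prog.branch 1 (Prog.push 2 true) (Prog.pop 1) (Prog.pop 1)))) (put [a, b, c])
      (put [[], b.drop a.length, List.replicate (a.length - b.length) true ++ c])
      (4 * a.length + 1) := by
    intro a
    induction a with
    | nil => intro b c; simpa using Runs.loopDone rfl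
    | cons x a ih =>
      intro b c
      have hp : Runs O (Prog.pop 0) (put [x :: a, b, c]) (put [a, b, c]) 1 :=
        Runs.pop (i := 0) (l := [x :: a, b, c]) (by simp)
      rcases b with _ | ⟨y, b⟩
      · have h2 : Runs O (Prog.branch 1 (Prog.push 2 true) (Prog.pop 1) (Prog.pop 1))
            (put [a, [], c]) (put [a, [], true :: c]) 2 :=
          Runs.branchEmpty rfl (Runs.push (i := 2) (l := [a, [], c]) (by simp) true)
        have := (Runs.loopStep (by simp [put]) (hp.seq h2) (ih [] (true :: c))).mono
          (T' := 4 * (x :: a).length + 1) (by simp; omega)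
        simpa [List.replicate_succ', List.append_assoc] using this
      · have h2 : Runs O (Prog.branch 1 (Prog.push 2 true) (Prog.pop 1) (Prog.pop 1))
            (put [a, y :: b, c]) (put [a, b, c]) 2 := by
          cases y
          · exact Runs.branchFalse rfl (Runs.pop (i := 1) (l := [a, false :: b, c]) (by simp))
          · exact Runs.branchTrue rfl (Runs.pop (i := 1) (l := [a, true :: b, c]) (by simp))
        have := (Runs.loopStep (by simp [put]) (hp.seq h2) (ih b c)).mono
          (T' := 4 * (x :: a).length + 1) (by simp; omega)
        simpa using this
  refine ⟨Prog.seq (Prog.loop 0 (Prog.seq (Prog.pop 0)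
      (Prog.branch 1 (Prog.push 2 true) (Prog.pop 1) (Prog.pop 1)))) (Prog.seq (clear 1)
      (Prog.branch 2 (Prog.push 0 true) (clear 2) (clear 2))), 8 * Polynomial.X + 5,
      fun a b => ?_⟩
  have h1 := main a b []
  have h2 := runs_clear (O := O) (i := 1)
    (l := [[], b.drop a.length, List.replicate (a.length - b.length) true ++ []]) (by simp)
  rw [put_pad 1 (l := [a, b]) rfl, put_pad 2 (l := [if a.length ≤ b.length then [true] else []])
    rfl]
  refine (h1.seq (h2.seq (n := 2 * a.length + 2) ?_)).mono (by simp; omega)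
  split_ifs with h
  · have e : a.length - b.length = 0 := by omega
    rw [e]
    exact (Runs.branchEmpty rfl (Runs.push (i := 0) (l := [[], [], []]) (by simp) true)).mono
      (by omega)
  · obtain ⟨k, hk⟩ : ∃ k, a.length - b.length = k + 1 := ⟨a.length - b.length - 1, by omega⟩
    rw [hk]
    have := runs_clear (O := O) (i := 2) (l := [[], [], List.replicate (k + 1) true]) (by simp)
    refine (Runs.branchTrue rfl (T := 2 * (k + 1) + 1) ?_).mono (by omega)
    simpa using this

open Classical in
theorem PolyOp.eq : PolyOp O (fun a b => if a = b then [true] else []) := by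
  -- Stack `2` becomes nonempty as soon as a difference has been found.
  let body : Prog := Prog.branch 0 Prog.skip
    (Prog.seq (Prog.pop 0) (Prog.branch 1 (Prog.push 2 true) (Prog.pop 1)
      (Prog.seq (Prog.pop 1) (Prog.push 2 true))))
    (Prog.seq (Prog.pop 0) (Prog.branch 1 (Prog.push 2 true)
      (Prog.seq (Prog.pop 1) (Prog.push 2 true)) (Prog.pop 1)))
  have main : ∀ a b c : Word, ∃ b' c' : Word, Runs O (Prog.loop 0 body) (put [a, b, c])
      (put [[], b', c']) (6 * a.length + 1) ∧ (b' = [] ∧ c' = [] ↔ a = b ∧ c = []) ∧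
      b'.length ≤ b.length ∧ c'.length ≤ c.length + a.length := by
    intro a
    induction a with
    | nil =>
      intro b c
      exact ⟨b, c, Runs.loopDone rfl, by simp [eq_comm], by simp, by simp⟩
    | cons x a ih =>
      intro b c
      have hp : Runs O (Prog.pop 0) (put [x :: a, b, c]) (put [a, b, c]) 1 :=
        Runs.pop (i := 0) (l := [x :: a, b, c]) (by simp)
      rcases b with _ | ⟨y, b⟩
      · obtain ⟨b', c', hr, he, hb, hc⟩ := ih [] (true :: c)
        have hq : Runs O (Prog.push 2 true) (put [a, [], c]) (put [a, [], true :: c]) 1 :=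
          Runs.push (i := 2) (l := [a, [], c]) (by simp) true
        refine ⟨b', c', (Runs.loopStep (m := 4) (by simp [put]) ?_ hr).mono
          (by simp; omega), ?_, by simpa using hb, by simp at hc ⊢; omega⟩
        · cases x with
          | false => exact Runs.branchFalse rfl (hp.seq (Runs.branchEmpty rfl hq))
          | true => exact Runs.branchTrue rfl (hp.seq (Runs.branchEmpty rfl hq))
        · simp [he]
      · have hp1 : Runs O (Prog.pop 1) (put [a, y :: b, c]) (put [a, b, c]) 1 :=
          Runs.pop (i := 1) (l := [a, y :: b, c]) (by simp)
        have hq : Runs O (Prog.push 2 true) (put [a, b, c]) (put [a, b, true :: c]) 1 :=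
          Runs.push (i := 2) (l := [a, b, c]) (by simp) true
        by_cases hxy : x = y
        · subst hxy
          obtain ⟨b', c', hr, he, hb, hc⟩ := ih b c
          refine ⟨b', c', (Runs.loopStep (m := 4) (by simp [put]) ?_ hr).mono
            (by simp; omega), ?_, by simp; omega, by simp; omega⟩
          · cases x with
            | false => exact Runs.branchFalse rfl (hp.seq (Runs.branchFalse rfl hp1))
            | true => exact Runs.branchTrue rfl (hp.seq (Runs.branchTrue rfl hp1))
          · simp [he]
        · obtain ⟨b', c', hr, he, hb, hc⟩ := ih b (true :: c)
          refine ⟨b', c', (Runs.loopStep (m := 5) (by simp [put]) ?_ hr).mono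
            (by simp; omega), ?_, by simp; omega, by simp at hc ⊢; omega⟩
          · cases x <;> cases y <;> simp at hxy
            · exact Runs.branchFalse rfl (hp.seq (Runs.branchTrue rfl (hp1.seq hq)))
            · exact Runs.branchTrue rfl (hp.seq (Runs.branchFalse rfl (hp1.seq hq)))
          · simp [he, hxy]
  let fin : Prog := Prog.branch 1 (Prog.branch 2 (Prog.push 0 true) Prog.skip Prog.skip)
    Prog.skip Prog.skip
  refine ⟨Prog.seq (Prog.loop 0 body) (Prog.seq fin (Prog.seq (clear 1) (clear 2))),
      10 * Polynomial.X + 6, fun a b => ?_⟩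
  obtain ⟨b', c', h1, he, hb, hc⟩ := main a b []
  have h2 : Runs O fin (put [[], b', c']) (put [if a = b then [true] else [], b', c']) 3 := by
    rcases b' with _ | ⟨x, b'⟩
    · rcases c' with _ | ⟨y, c'⟩
      · have : a = b := by simpa using he
        rw [if_pos this]
        exact Runs.branchEmpty rfl (Runs.branchEmpty rfl
          (Runs.push (i := 0) (l := [[], [], []]) (by simp) true))
      · have : a ≠ b := by simpa using he
        rw [if_neg this]
        cases y with
        | false => exact Runs.branchEmpty rfl (Runs.branchFalse rfl (Runs.skip _))
        | true => exact Runs.branchEmpty rfl (Runs.branchTrue rfl (Runs.skip _))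
    · have : a ≠ b := by simpa using he
      rw [if_neg this]
      cases x with
      | false => exact (Runs.branchFalse rfl (Runs.skip _)).mono (by omega)
      | true => exact (Runs.branchTrue rfl (Runs.skip _)).mono (by omega)
  have h3 := runs_clear (O := O) (i := 1) (l := [if a = b then [true] else [], b', c']) (by simp)
  have h4 := runs_clear (O := O) (i := 2) (l := [if a = b then [true] else [], [], c']) (by simp)
  rw [put_pad 1 (l := [a, b]) rfl, put_pad 2 (l := [if a = b then [true] else []]) rfl]
  refine (h1.seq (h2.seq (h3.seq h4))).mono ?_
  simp at hc ⊢
  omega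

/-! ### Loops over the blocks of a word -/

/-- The body of the loop of `parse`. -/
def parseBody : Prog :=
  Prog.branch 0 (Prog.pop 1) (Prog.seq (Prog.pop 0) (Prog.pop 1))
    (Prog.seq (Prog.pop 0) (Prog.branch 0 (Prog.pop 1)
      (Prog.seq (Prog.pop 0) (Prog.push 2 false)) (Prog.seq (Prog.pop 0) (Prog.push 2 true))))

/-- Move the content of the first block of stack `0`, reversed, to stack `2`. Stack `1` is
nonempty as long as the end of the block has not been reached. -/
def parse : Prog := Prog.seq (Prog.push 1 true) (Prog.loop 1 parseBody)

theorem runs_parseLoop : ∀ w c : Word, Runs O (Prog.loop 1 parseBody) (put [w, [true], c])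
    (put [tl w, [], (hd w).reverse ++ c]) (6 * w.length + 6)
  | [], c => by
    have h : Runs O (Prog.pop 1) (put [[], [true], c]) (put [[], [], c]) 1 :=
      Runs.pop (i := 1) (l := [[], [true], c]) (by simp)
    exact ((Runs.loopStep (by simp [put]) (Runs.branchEmpty rfl h)
      (Runs.loopDone rfl))).mono (by omega)
  | false :: w, c => by
    have h0 : Runs O (Prog.pop 0) (put [false :: w, [true], c]) (put [w, [true], c]) 1 :=
      Runs.pop (i := 0) (l := [false :: w, [true], c]) (by simp)
    have h : Runs O (Prog.pop 1) (put [w, [true], c]) (put [w, [], c]) 1 :=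
      Runs.pop (i := 1) (l := [w, [true], c]) (by simp)
    exact ((Runs.loopStep (by simp [put]) (Runs.branchFalse rfl (h0.seq h))
      (Runs.loopDone rfl))).mono (by omega)
  | [true], c => by
    have h0 : Runs O (Prog.pop 0) (put [[true], [true], c]) (put [[], [true], c]) 1 :=
      Runs.pop (i := 0) (l := [[true], [true], c]) (by simp)
    have h : Runs O (Prog.pop 1) (put [[], [true], c]) (put [[], [], c]) 1 :=
      Runs.pop (i := 1) (l := [[], [true], c]) (by simp)
    exact ((Runs.loopStep (by simp [put]) (Runs.branchTrue rfl
      (h0.seq (Runs.branchEmpty rfl h))) (Runs.loopDone rfl))).mono (by simp)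
  | true :: b :: w, c => by
    have h0 : Runs O (Prog.pop 0) (put [true :: b :: w, [true], c]) (put [b :: w, [true], c]) 1 :=
      Runs.pop (i := 0) (l := [true :: b :: w, [true], c]) (by simp)
    have h1 : Runs O (Prog.pop 0) (put [b :: w, [true], c]) (put [w, [true], c]) 1 :=
      Runs.pop (i := 0) (l := [b :: w, [true], c]) (by simp)
    have h2 : Runs O (Prog.push 2 b) (put [w, [true], c]) (put [w, [true], b :: c]) 1 :=
      Runs.push (i := 2) (l := [w, [true], c]) (by simp) b
    have h3 : Runs O parseBody (put [true :: b :: w, [true], c]) (put [w, [true], b :: c]) 5 := by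
      refine Runs.branchTrue rfl (h0.seq (n := 3) ?_)
      cases b with
      | false => exact Runs.branchFalse rfl (h1.seq h2)
      | true => exact Runs.branchTrue rfl (h1.seq h2)
    have := (Runs.loopStep (by simp [put]) h3 (runs_parseLoop w (b :: c))).mono
      (T' := 6 * (true :: b :: w).length + 6) (by simp; omega)
    simpa [hd, tl] using this

theorem runs_parse (w : Word) :
    Runs O parse (put [w]) (put [tl w, [], (hd w).reverse]) (6 * w.length + 7) := by
  have h1 : Runs O (Prog.push 1 true) (put [w, [], []]) (put [w, [true], []]) 1 :=
    Runs.push (i := 1) (l := [w, [], []]) (by simp) true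
  rw [put_pad 2 (l := [w]) rfl]
  have := h1.seq (runs_parseLoop w [])
  rw [List.append_nil] at this
  exact this.mono (by omega)

namespace PolyFun

theorem hd : PolyFun O hd := by
  refine ⟨Prog.seq parse (Prog.seq (clear 0) (moveRev 2 0)), 12 * Polynomial.X + 9, fun w => ?_⟩
  have h2 : Runs O (clear 0) (put [tl w, [], (PH.hd w).reverse])
      (put [[], [], (PH.hd w).reverse]) (2 * (tl w).length + 1) := by
    simpa using runs_clear (O := O) (i := 0) (l := [tl w, [], (PH.hd w).reverse]) (by simp)
  have h3 : Runs O (moveRev 2 0) (put [[], [], (PH.hd w).reverse])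
      (put [PH.hd w, [], []]) (4 * (PH.hd w).length + 1) := by
    simpa using runs_moveRev (O := O) (i := 2) (j := 0) (l := [[], [], (PH.hd w).reverse])
      (by simp) (by simp) (by simp)
  rw [put_pad 2 (l := [PH.hd w]) rfl]
  have := length_hd_le w
  have := length_tl_le w
  refine ((runs_parse w).seq (h2.seq h3)).mono ?_
  simp; omega

theorem tl : PolyFun O tl := by
  refine ⟨Prog.seq parse (clear 2), 8 * Polynomial.X + 8, fun w => ?_⟩
  have h2 : Runs O (clear 2) (put [PH.tl w, [], (PH.hd w).reverse])
      (put [PH.tl w, [], []]) (2 * (PH.hd w).length + 1) := by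
    simpa using runs_clear (O := O) (i := 2) (l := [PH.tl w, [], (PH.hd w).reverse]) (by simp)
  rw [put_pad 2 (l := [PH.tl w]) rfl]
  have := length_hd_le w
  refine ((runs_parse w).seq h2).mono ?_
  simp; omega

/-- Concatenate the values of `F` on the words of a sequence. This is the only form of iteration
that is needed: as the argument of `F` does not depend on the words produced so far, the total time
is polynomial. -/
theorem flatMap {g : Word → Word} {F : Word → Word → Word} (hg : PolyFun O g)
    (hF : PolyFun O (fun v => F (PH.hd v) (PH.tl v))) :
    PolyFun O (fun w => (untuple (g w)).flatMap (fun x => F x w)) := by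
  obtain ⟨P, p, hP⟩ := hF
  obtain ⟨R, r, hR⟩ := PolyFun.id.two hg
  let body : Prog := Prog.seq (parse.shift 2) (Prog.seq (moveRev 1 5) (Prog.seq (moveRev₂ 5 1 3)
    (Prog.seq (emit 4 3) (Prog.seq (P.shift 3) (moveRev 3 0)))))
  let B : ℕ → ℕ → ℕ := fun m n => 19 * m + 13 * n + 16 + 5 * p.eval (2 * m + 1 + n)
  have hbody : ∀ (m : ℕ) (acc w l : Word), l.length ≤ m →
      Runs O body (put [acc, w, l])
        (put [(F (PH.hd l) w).reverse ++ acc, w, PH.tl l]) (B m w.length) := by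
    intro m acc w l hl
    have hh := length_hd_le l
    set x := PH.hd l with hx
    set l' := PH.tl l
    have h1 := (runs_parse (O := O) l).shift [acc, w] (k := 2) rfl
    rw [put_pad 1 (l := [acc, w] ++ [PH.tl l, [], (PH.hd l).reverse]) rfl] at h1
    have h2 : Runs O (moveRev 1 5) (put [acc, w, l', [], x.reverse, []])
        (put [acc, [], l', [], x.reverse, w.reverse]) (4 * w.length + 1) := by
      simpa using runs_moveRev (O := O) (i := 1) (j := 5) (l := [acc, w, l', [], x.reverse, []])
        (by simp) (by simp) (by simp)
    have h3 : Runs O (moveRev₂ 5 1 3) (put [acc, [], l', [], x.reverse, w.reverse])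
        (put [acc, w, l', w, x.reverse, []]) (5 * w.length + 1) := by
      simpa using runs_moveRev₂ (O := O) (i := 5) (j := 1) (k := 3)
        (l := [acc, [], l', [], x.reverse, w.reverse])
        (by simp) (by simp) (by simp) (by simp) (by simp) (by simp)
    have h4 : Runs O (emit 4 3) (put [acc, w, l', w, x.reverse, []])
        (put [acc, w, l', PH.block x ++ w, [], []]) (5 * x.length + 2) := by
      simpa using runs_emit (O := O) (i := 4) (j := 3) (l := [acc, w, l', w, x.reverse, []])
        (by simp) (by simp) (by simp)
    have h5 := hP (PH.block x ++ w)
    have hlen := h5.length_le 0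
    have h5 := h5.shift [acc, w, l'] (k := 3) rfl
    rw [put_pad 2 (l := [acc, w, l'] ++ [PH.block x ++ w]) rfl] at h5
    simp only [hd_block_append, tl_block_append, List.cons_append, List.nil_append,
      List.getD_cons_zero, List.length_append, length_block] at h5 hlen
    have h6 : Runs O (moveRev 3 0) (put [acc, w, l', F x w])
        (put [(F x w).reverse ++ acc, w, l']) (4 * (F x w).length + 1) := by
      rw [put_pad 1 (l := [(F x w).reverse ++ acc, w, l']) rfl]
      simpa using runs_moveRev (O := O) (i := 3) (j := 0) (l := [acc, w, l', F x w])
        (by simp) (by simp) (by simp)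
    have hm := eval_mono p (show 2 * x.length + 1 + w.length ≤ 2 * m + 1 + w.length by omega)
    refine (h1.seq (h2.seq (h3.seq (h4.seq (h5.seq h6))))).mono ?_
    simp only [B]
    omega
  have hloop : ∀ (k m : ℕ) (acc w l : Word), l.length ≤ m → l.length ≤ k →
      Runs O (Prog.loop 2 body) (put [acc, w, l])
        (put [((untuple l).flatMap (fun x => F x w)).reverse ++ acc, w, []])
        ((B m w.length + 1) * k + 1) := by
    intro k
    induction k with
    | zero =>
      intro m acc w l _ hk
      have : l = [] := by simpa using hk
      subst this
      rw [untuple_nil]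
      exact (Runs.loopDone rfl).mono (by omega)
    | succ k ih =>
      intro m acc w l hm hk
      by_cases hl : l = []
      · subst hl
        rw [untuple_nil]
        exact (Runs.loopDone rfl).mono (by omega)
      · have hlt := length_tl_lt hl
        have := (Runs.loopStep (by simpa [put] using hl) (hbody m acc w l hm)
          (ih m ((F (PH.hd l) w).reverse ++ acc) w (PH.tl l) (by omega) (by omega))).mono
          (T' := (B m w.length + 1) * (k + 1) + 1) (by rw [Nat.mul_add]; omega)
        rw [untuple_of_ne hl]
        simpa using this
  obtain ⟨q, hq⟩ : ∃ q : Polynomial ℕ, ∀ n, (B (r.eval n) n + 1) * r.eval n + 1 ≤ q.eval n :=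
    ⟨(19 * r + 13 * Polynomial.X + 16 + 5 * p.comp (2 * r + 1 + Polynomial.X) + 1) * r + 1,
      fun n => by simp [B]⟩
  refine ⟨Prog.seq R (Prog.seq (moveRev 1 3) (Prog.seq (moveRev 3 2) (Prog.seq (moveRev 0 3)
    (Prog.seq (moveRev 3 1) (Prog.seq (Prog.loop 2 body) (Prog.seq (clear 1)
    (Prog.seq (moveRev 0 1) (Prog.seq (moveRev 1 2) (moveRev 2 0))))))))),
    9 * r + 10 * Polynomial.X + 8 + 13 * q, fun w => ?_⟩
  set l := g w
  set out := (untuple l).flatMap (fun x => F x w)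
  have hl := (hR w).length_le 1
  simp only [List.getD_cons_succ, List.getD_cons_zero, List.getD_nil, List.length_nil,
    zero_add] at hl
  change l.length ≤ _ at hl
  have h1 := hR w
  rw [put_pad 2 (l := [w, g w]) rfl] at h1
  have h2 : Runs O (moveRev 1 3) (put [w, l, [], []]) (put [w, [], [], l.reverse])
      (4 * l.length + 1) := by
    simpa using runs_moveRev (O := O) (i := 1) (j := 3) (l := [w, l, [], []])
      (by simp) (by simp) (by simp)
  have h3 : Runs O (moveRev 3 2) (put [w, [], [], l.reverse]) (put [w, [], l, []])
      (4 * l.length + 1) := by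
    simpa using runs_moveRev (O := O) (i := 3) (j := 2) (l := [w, [], [], l.reverse])
      (by simp) (by simp) (by simp)
  have h4 : Runs O (moveRev 0 3) (put [w, [], l, []]) (put [[], [], l, w.reverse])
      (4 * w.length + 1) := by
    simpa using runs_moveRev (O := O) (i := 0) (j := 3) (l := [w, [], l, []])
      (by simp) (by simp) (by simp)
  have h5 : Runs O (moveRev 3 1) (put [[], [], l, w.reverse]) (put [[], w, l])
      (4 * w.length + 1) := by
    rw [put_pad 1 (l := [[], w, l]) rfl]
    simpa using runs_moveRev (O := O) (i := 3) (j := 1) (l := [[], [], l, w.reverse])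
      (by simp) (by simp) (by simp)
  have h6 := hloop (r.eval w.length) (r.eval w.length) [] w l hl hl
  have hlen := h6.length_le 0
  simp only [List.append_nil, List.getD_cons_zero, List.length_nil, List.length_reverse] at h6 hlen
  have h7 : Runs O (clear 1) (put [out.reverse, w, []]) (put [out.reverse, [], []])
      (2 * w.length + 1) := by
    simpa using runs_clear (O := O) (i := 1) (l := [out.reverse, w, []]) (by simp)
  have h8 : Runs O (moveRev 0 1) (put [out.reverse, [], []]) (put [[], out, []])
      (4 * out.length + 1) := by
    simpa using runs_moveRev (O := O) (i := 0) (j := 1) (l := [out.reverse, [], []])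
      (by simp) (by simp) (by simp)
  have h9 : Runs O (moveRev 1 2) (put [[], out, []]) (put [[], [], out.reverse])
      (4 * out.length + 1) := by
    simpa using runs_moveRev (O := O) (i := 1) (j := 2) (l := [[], out, []])
      (by simp) (by simp) (by simp)
  have h10 : Runs O (moveRev 2 0) (put [[], [], out.reverse]) (put [out, [], []])
      (4 * out.length + 1) := by
    simpa using runs_moveRev (O := O) (i := 2) (j := 0) (l := [[], [], out.reverse])
      (by simp) (by simp) (by simp)
  rw [put_pad 2 (l := [out]) rfl]
  refine (h1.seq (h2.seq (h3.seq (h4.seq (h5.seq (h6.seq (h7.seq (h8.seq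
    (h9.seq h10))))))))).mono ?_
  have := hq w.length
  change out.length ≤ _ at hlen
  simp
  omega

theorem length_le {f : Word → Word} (hf : PolyFun O f) :
    ∃ p : Polynomial ℕ, ∀ w, (f w).length ≤ p.eval w.length := by
  obtain ⟨P, p, hP⟩ := hf
  refine ⟨Polynomial.X + p, fun w => ?_⟩
  simpa using (hP w).length_le 0

end PolyFun

/-! ### Properties of words that are decidable in polynomial time -/

open Classical in
/-- The property `p` is decided in polynomial time by a program that cleans up after itself; the
answer is `[true]` or the empty word. -/
def PolyDec (O : Set Word) (p : Word → Prop) : Prop :=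
  PolyFun O (fun w => if p w then [true] else [])

namespace PolyDec

theorem of_fun {f : Word → Word} (hf : PolyFun O f) : PolyDec O (fun w => f w ≠ []) := by
  unfold PolyDec
  have := hf.ite_nil (PolyFun.const []) (PolyFun.const [true])
  refine Eq.mp (congrArg _ (funext fun w => ?_)) this
  by_cases h : f w = [] <;> simp [h]

theorem ite {p : Word → Prop} [∀ w, Decidable (p w)] {f g : Word → Word} (hp : PolyDec O p)
    (hf : PolyFun O f) (hg : PolyFun O g) : PolyFun O (fun w => if p w then f w else g w) := by
  refine Eq.mp (congrArg _ (funext fun w => ?_)) (PolyFun.ite_nil hp hg hf)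
  by_cases h : p w <;> simp [h]

theorem congr {p q : Word → Prop} (hp : PolyDec O p) (h : ∀ w, q w ↔ p w) : PolyDec O q := by
  have : q = p := funext fun w => propext (h w)
  rwa [this]

theorem comp {p : Word → Prop} {f : Word → Word} (hp : PolyDec O p) (hf : PolyFun O f) :
    PolyDec O (fun w => p (f w)) := PolyFun.comp hp hf

open Classical in
theorem not {p : Word → Prop} (hp : PolyDec O p) : PolyDec O (fun w => ¬ p w) :=
  (of_fun (hp.ite (PolyFun.const []) (PolyFun.const [true]))).congr fun w => by
    by_cases h : p w <;> simp [h]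

open Classical in
theorem and {p q : Word → Prop} (hp : PolyDec O p) (hq : PolyDec O q) :
    PolyDec O (fun w => p w ∧ q w) :=
  (of_fun (hp.ite hq (PolyFun.const []))).congr fun w => by
    by_cases h : p w <;> by_cases h' : q w <;> simp [h, h']

theorem imp {p q : Word → Prop} (hp : PolyDec O p) (hq : PolyDec O q) :
    PolyDec O (fun w => p w → q w) :=
  (hp.and hq.not).not.congr fun w => by tauto

theorem iff {p q : Word → Prop} (hp : PolyDec O p) (hq : PolyDec O q) :
    PolyDec O (fun w => p w ↔ q w) :=
  ((hp.imp hq).and (hq.imp hp)).congr fun w => by tauto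

theorem eq {f g : Word → Word} (hf : PolyFun O f) (hg : PolyFun O g) :
    PolyDec O (fun w => f w = g w) := by
  unfold PolyDec
  refine Eq.mp (congrArg _ (funext fun w => ?_)) (PolyOp.eq.comp hf hg)
  by_cases h : f w = g w <;> simp [h]

theorem length_le {f g : Word → Word} (hf : PolyFun O f) (hg : PolyFun O g) :
    PolyDec O (fun w => (f w).length ≤ (g w).length) := by
  unfold PolyDec
  refine Eq.mp (congrArg _ (funext fun w => ?_)) (PolyOp.lengthLe.comp hf hg)
  by_cases h : (f w).length ≤ (g w).length <;> simp [h]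

theorem exists_mem {g : Word → Word} {p : Word → Word → Prop} (hg : PolyFun O g)
    (hp : PolyDec O (fun v => p (hd v) (tl v))) :
    PolyDec O (fun w => ∃ x ∈ untuple (g w), p x w) := by
  classical
  refine (of_fun (hg.flatMap (F := fun x w => if p x w then [true] else []) hp)).congr fun w => ?_
  simp [List.flatMap_eq_nil_iff]

theorem forall_mem {g : Word → Word} {p : Word → Word → Prop} (hg : PolyFun O g)
    (hp : PolyDec O (fun v => p (hd v) (tl v))) :
    PolyDec O (fun w => ∀ x ∈ untuple (g w), p x w) :=
  (exists_mem (p := fun x w => ¬ p x w) hg hp.not).not.congr fun w => by simp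

theorem mem {f g : Word → Word} (hf : PolyFun O f) (hg : PolyFun O g) :
    PolyDec O (fun w => f w ∈ untuple (g w)) :=
  (exists_mem (p := fun x w => x = f w) hg
    (eq PolyFun.hd (hf.comp PolyFun.tl))).congr fun w => by simp

/-- Empty the stacks `1, …, n`. -/
def clearUpTo : ℕ → Prog
  | 0 => Prog.skip
  | n + 1 => Prog.seq (clearUpTo n) (clear (n + 1))

theorem runs_clearUpTo (a : Word) (l : List Word) (M : ℕ) (hM : ∀ w ∈ l, w.length ≤ M) (n : ℕ)
    (hn : n ≤ l.length) : Runs O (clearUpTo n) (put (a :: l))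
      (put (a :: (List.replicate n [] ++ l.drop n))) (n * (2 * M + 1) + 1) := by
  induction n with
  | zero => simpa [clearUpTo] using Runs.skip (O := O) (put (a :: l))
  | succ n ih =>
    have h := runs_clear (O := O) (i := n + 1) (l := a :: (List.replicate n [] ++ l.drop n))
      (by simp; omega)
    have e : (a :: (List.replicate n [] ++ l.drop n)).set (n + 1) [] =
        a :: (List.replicate (n + 1) [] ++ l.drop (n + 1)) := by
      rw [List.drop_eq_getElem_cons (show n < l.length by omega), List.set_cons_succ,
        List.set_append_right _ _ (by simp)]
      simp [List.replicate_succ', -List.getElem_cons_drop]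
    have e' : (a :: (List.replicate n [] ++ l.drop n)).getD (n + 1) [] = l[n] := by
      simp [show n < l.length by omega]
    rw [e, e'] at h
    have := hM l[n] (List.getElem_mem _)
    exact ((ih (by omega)).seq h).mono (by rw [Nat.add_mul]; omega)

theorem of_inP {L : Set Word} (hL : InP L) : PolyDec ∅ (fun w => w ∈ L) := by
  obtain ⟨f, hf, P, p, hP⟩ := hL
  let W := P.width
  refine ⟨Prog.seq P (Prog.seq (clearUpTo W) (Prog.branch 0 Prog.skip (Prog.pop 0) Prog.skip)),
    p + Polynomial.C W * (2 * p + 1) + 3, fun w => ?_⟩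
  obtain ⟨s, t, hs, ht, h0⟩ := hP w
  simp only [id] at hs ht
  have hs' : s = put ([f w] :: (List.range W).map (fun i => s (i + 1))) := by
    funext r
    rcases r with _ | r
    · simpa [put] using h0
    · by_cases hr : r < W
      · simp [put, hr]
      · have : s (r + 1) = initial w (r + 1) := hs.eq_of_width_le (r + 1) (by omega)
        rw [this]
        simp [put, hr, initial, Function.update]
  have h1 : Runs ∅ P (put [w]) s (p.eval w.length) := ⟨t, ht, by rwa [← initial_eq_put]⟩
  have h2 := runs_clearUpTo (O := ∅) [f w] ((List.range W).map (fun i => s (i + 1)))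
    (p.eval w.length) (by
      intro u hu
      obtain ⟨i, _, rfl⟩ := List.mem_map.1 hu
      have := hs.length_le (i + 1)
      simp [initial, Function.update] at this
      omega) W (by simp)
  rw [← hs', List.drop_of_length_le (by simp), List.append_nil,
    ← put_pad W (l := [[f w]]) (l' := [f w] :: List.replicate W []) rfl] at h2
  refine (h1.seq (h2.seq (n := 2) ?_)).mono (by simp; ring_nf; omega)
  have hw := hf w
  beta_reduce
  cases hb : f w
  · rw [hb] at hw
    rw [if_neg (by simpa using hw)]
    exact Runs.branchFalse rfl (Runs.pop (i := 0) (l := [[false]]) (by simp))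
  · rw [hb] at hw
    rw [if_pos (by simpa using hw)]
    exact Runs.branchTrue rfl (Runs.skip _)

theorem inP {p : Word → Prop} (hp : PolyDec ∅ p) : InP {w | p w} := by
  classical
  obtain ⟨P, q, hP⟩ := hp.ite (PolyFun.const [true]) (PolyFun.const [false])
  refine ⟨fun w => decide (p w), by simp, P, q, fun w => ?_⟩
  obtain ⟨t, ht, h⟩ := hP w
  refine ⟨_, t, by rwa [initial_eq_put], ht, ?_⟩
  by_cases h : p w <;> simp [put, h]

end PolyDec

/-! ### Two quantifiers, and searching with an oracle -/

theorem length_tuple_pair (x u : Word) :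
    (tuple [x, u]).length = 2 * x.length + 2 * u.length + 2 := by
  simp [tuple, length_block]; omega

/-- A polynomially bounded existential quantifier followed by a polynomially bounded universal one,
in front of a property that is decidable in polynomial time, yields a language in `Σᵖ₂`. -/
theorem inSigma_two {N : Word → Word → Word → Prop}
    (hN : PolyDec ∅ (fun y => N (hd (hd y)) (hd (tl (hd y))) (hd (tl y))))
    (p q : Polynomial ℕ) :
    InSigma 2 {x | ∃ u : Word, u.length ≤ p.eval x.length ∧
      ∀ v : Word, v.length ≤ q.eval (tuple [x, u]).length → N x u v} := by
  refine ⟨{y | ∀ v : Word, v.length ≤ q.eval y.length → N (hd y) (hd (tl y)) v}, ?_, p,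
    fun x => by simp⟩
  refine ⟨{y | ¬ N (hd (hd y)) (hd (tl (hd y))) (hd (tl y))}, ?_, q, fun y => by simp⟩
  have := hN.inP
  show InP _
  convert this using 1
  ext y
  simp

theorem Runs.askYes {l : List Word} {i : ℕ} (hi : i < l.length) (h : l.getD i [] ∈ O) :
    Runs O (Prog.ask i) (put l) (put (l.set i [true])) 1 := by
  rw [← update_put hi]
  exact ⟨1, le_rfl, Exec.askYes h⟩

theorem Runs.askNo {l : List Word} {i : ℕ} (hi : i < l.length) (h : l.getD i [] ∉ O) :
    Runs O (Prog.ask i) (put l) (put (l.set i [false])) 1 := by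
  rw [← update_put hi]
  exact ⟨1, le_rfl, Exec.askNo h⟩

/-- Copy stack `0` to the empty stack `2`. -/
def copy : Prog := Prog.seq (moveRev 0 3) (moveRev₂ 3 0 2)

theorem runs_copy (w f : Word) :
    Runs O copy (put [w, f]) (put [w, f, w]) (9 * w.length + 2) := by
  have h1 : Runs O (moveRev 0 3) (put [w, f, [], []]) (put [[], f, [], w.reverse])
      (4 * w.length + 1) := by
    simpa using runs_moveRev (O := O) (i := 0) (j := 3) (l := [w, f, [], []])
      (by simp) (by simp) (by simp)
  have h2 : Runs O (moveRev₂ 3 0 2) (put [[], f, [], w.reverse]) (put [w, f, w, []])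
      (5 * w.length + 1) := by
    simpa using runs_moveRev₂ (O := O) (i := 3) (j := 0) (k := 2) (l := [[], f, [], w.reverse])
      (by simp) (by simp) (by simp) (by simp) (by simp) (by simp)
  rw [put_pad 2 (l := [w, f]) rfl, put_pad 1 (l := [w, f, w]) rfl]
  exact (h1.seq h2).mono (by omega)

/-- Extend the word on stack `0` by one bit, as advised by the oracle. -/
def extendBit : Prog :=
  Prog.seq copy (Prog.seq (Prog.push 2 true) (Prog.seq (Prog.push 2 true) (Prog.seq (Prog.ask 2)
    (Prog.branch 2 Prog.skip
      (Prog.seq (Prog.pop 2) (Prog.seq (Prog.push 0 false) (Prog.push 0 true)))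
      (Prog.seq (Prog.pop 2) (Prog.seq (Prog.push 0 true) (Prog.push 0 true)))))))

/-- Ask the oracle whether the word on stack `0` is complete. If so, empty stack `1`, otherwise
extend the word by one bit. -/
def searchStep : Prog :=
  Prog.seq copy (Prog.seq (Prog.push 2 false) (Prog.seq (Prog.ask 2)
    (Prog.branch 2 Prog.skip (Prog.seq (Prog.pop 2) extendBit)
      (Prog.seq (Prog.pop 2) (Prog.pop 1)))))

theorem runs_extendBit (z w f : Word) {b : Bool}
    (hb : b = true ↔ block (true :: z) ++ w ∈ O) :
    Runs O extendBit (put [block z ++ w, f]) (put [block (b :: z) ++ w, f])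
      (9 * (block z ++ w).length + 9) := by
  set A := block z ++ w with hA
  have h1 := runs_copy (O := O) A f
  have h2 : Runs O (Prog.push 2 true) (put [A, f, A]) (put [A, f, true :: A]) 1 :=
    Runs.push (i := 2) (l := [A, f, A]) (by simp) true
  have h3 : Runs O (Prog.push 2 true) (put [A, f, true :: A])
      (put [A, f, true :: true :: A]) 1 :=
    Runs.push (i := 2) (l := [A, f, true :: A]) (by simp) true
  have h4 : Runs O (Prog.ask 2) (put [A, f, true :: true :: A]) (put [A, f, [b]]) 1 := by
    cases b
    · exact Runs.askNo (i := 2) (l := [A, f, true :: true :: A]) (by simp)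
        (fun h => by simpa using hb.2 h)
    · exact Runs.askYes (i := 2) (l := [A, f, true :: true :: A]) (by simp) (hb.1 rfl)
  have h5 : Runs O (Prog.pop 2) (put [A, f, [b]]) (put [A, f]) 1 := by
    rw [put_pad 1 (l := [A, f]) rfl]
    exact Runs.pop (i := 2) (l := [A, f, [b]]) (by simp)
  have h6 : Runs O (Prog.push 0 b) (put [A, f]) (put [b :: A, f]) 1 :=
    Runs.push (i := 0) (l := [A, f]) (by simp) b
  have h7 : Runs O (Prog.push 0 true) (put [b :: A, f]) (put [true :: b :: A, f]) 1 :=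
    Runs.push (i := 0) (l := [b :: A, f]) (by simp) true
  refine (h1.seq (h2.seq (h3.seq (h4.seq (n := 4) ?_)))).mono (by omega)
  cases b
  · exact Runs.branchFalse rfl (h5.seq (h6.seq h7))
  · exact Runs.branchTrue rfl (h5.seq (h6.seq h7))

theorem runs_searchStep_complete (A : Word) (h : false :: A ∈ O) :
    Runs O searchStep (put [A, [true]]) (put [A, []]) (9 * A.length + 7) := by
  have h1 := runs_copy (O := O) A [true]
  have h2 : Runs O (Prog.push 2 false) (put [A, [true], A]) (put [A, [true], false :: A]) 1 :=
    Runs.push (i := 2) (l := [A, [true], A]) (by simp) false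
  have h3 : Runs O (Prog.ask 2) (put [A, [true], false :: A]) (put [A, [true], [true]]) 1 :=
    Runs.askYes (i := 2) (l := [A, [true], false :: A]) (by simp) h
  have h4 : Runs O (Prog.pop 2) (put [A, [true], [true]]) (put [A, [true], []]) 1 :=
    Runs.pop (i := 2) (l := [A, [true], [true]]) (by simp)
  have h5 : Runs O (Prog.pop 1) (put [A, [true], []]) (put [A, []]) 1 := by
    rw [put_pad 1 (l := [A, []]) rfl]
    exact Runs.pop (i := 1) (l := [A, [true], []]) (by simp)
  exact (h1.seq (h2.seq (h3.seq (Runs.branchTrue rfl (h4.seq h5))))).mono (by omega)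

theorem runs_searchStep_incomplete (z w : Word) {b : Bool} (h : false :: (block z ++ w) ∉ O)
    (hb : b = true ↔ block (true :: z) ++ w ∈ O) :
    Runs O searchStep (put [block z ++ w, [true]]) (put [block (b :: z) ++ w, [true]])
      (18 * (block z ++ w).length + 15) := by
  set A := block z ++ w with hA
  have h1 := runs_copy (O := O) A [true]
  have h2 : Runs O (Prog.push 2 false) (put [A, [true], A]) (put [A, [true], false :: A]) 1 :=
    Runs.push (i := 2) (l := [A, [true], A]) (by simp) false
  have h3 : Runs O (Prog.ask 2) (put [A, [true], false :: A]) (put [A, [true], [false]]) 1 :=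
    Runs.askNo (i := 2) (l := [A, [true], false :: A]) (by simp) h
  have h4 : Runs O (Prog.pop 2) (put [A, [true], [false]]) (put [A, [true]]) 1 := by
    rw [put_pad 1 (l := [A, [true]]) rfl]
    exact Runs.pop (i := 2) (l := [A, [true], [false]]) (by simp)
  have h5 := runs_extendBit z w [true] hb
  rw [← hA] at h5
  exact (h1.seq (h2.seq (h3.seq (Runs.branchFalse rfl (h4.seq h5))))).mono (by omega)

/-- Search with an oracle: if the oracle answers, for every word `z`, whether the reverse of `z` is
one of the solutions `V a`, and whether it can be extended to one of them, then a solution is found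
bit by bit. -/
theorem exists_search {α : Type*} (ea : α → Word) (V : α → Set Word) (p : Polynomial ℕ)
    (hne : ∀ a, (V a).Nonempty) (hlen : ∀ a, ∀ v ∈ V a, v.length ≤ p.eval (ea a).length)
    (hcomplete : ∀ a z, false :: (block z ++ ea a) ∈ O ↔ z.reverse ∈ V a)
    (hextend : ∀ a z, z ≠ [] → (block z ++ ea a ∈ O ↔ ∃ y, z.reverse ++ y ∈ V a)) :
    ∃ (P : Prog) (q : Polynomial ℕ), ∀ a, ∃ v ∈ V a, ∃ (s : Store) (t : ℕ),
      Exec O P (initial (ea a)) s t ∧ t ≤ q.eval (ea a).length ∧ s 0 = v := by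
  obtain ⟨R, r, hR⟩ := (PolyFun.reverse (O := O)).comp PolyFun.hd
  refine ⟨Prog.seq (Prog.push 0 false) (Prog.seq (Prog.push 1 true)
    (Prog.seq (Prog.loop 1 searchStep) R)),
    2 + ((18 * (2 * p + 1 + Polynomial.X) + 16) * (p + 1) + 1) +
      r.comp (2 * p + 1 + Polynomial.X), fun a => ?_⟩
  set w := ea a with hw
  set M := p.eval w.length with hM
  set C := 18 * (2 * M + 1 + w.length) + 15 with hC
  have loop : ∀ (k : ℕ) (z : Word), M - z.length ≤ k → (∃ y, z.reverse ++ y ∈ V a) →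
      ∃ v ∈ V a, Runs O (Prog.loop 1 searchStep) (put [block z ++ w, [true]])
        (put [block v.reverse ++ w, []]) ((C + 1) * (k + 1) + 1) := by
    intro k
    induction k with
    | zero =>
      intro z hk ⟨y, hy⟩
      have hy' : z.length + y.length ≤ M := by simpa using hlen a _ hy
      have : y = [] := List.length_eq_zero_iff.1 (by omega)
      subst this
      rw [List.append_nil] at hy
      refine ⟨z.reverse, hy, ?_⟩
      rw [List.reverse_reverse]
      have hA : (block z ++ w).length ≤ 2 * M + 1 + w.length := by
        simp only [List.length_append, length_block]; omega
      exact (Runs.loopStep (by simp [put])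
        (runs_searchStep_complete (block z ++ w) ((hcomplete a z).2 hy))
        (Runs.loopDone rfl)).mono (by omega)
    | succ k ih =>
      intro z hk ⟨y, hy⟩
      have hy' : z.length + y.length ≤ M := by simpa using hlen a _ hy
      have hA : (block z ++ w).length ≤ 2 * M + 1 + w.length := by
        simp only [List.length_append, length_block]; omega
      by_cases hz : z.reverse ∈ V a
      · refine ⟨z.reverse, hz, ?_⟩
        rw [List.reverse_reverse]
        exact (Runs.loopStep (by simp [put])
          (runs_searchStep_complete (block z ++ w) ((hcomplete a z).2 hz)) (Runs.loopDone rfl)).mono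
          (by rw [Nat.mul_add _ _ 1]; omega)
      · rcases y with _ | ⟨b', y⟩
        · simp [hz] at hy
        rw [List.length_cons] at hy'
        obtain ⟨b, hb, y', hby⟩ : ∃ b : Bool, (b = true ↔ block (true :: z) ++ w ∈ O) ∧
            ∃ y, (b :: z).reverse ++ y ∈ V a := by
          by_cases ht : block (true :: z) ++ w ∈ O
          · exact ⟨true, by simp [ht], (hextend a (true :: z) (by simp)).1 ht⟩
          · refine ⟨false, by simp [ht], y, ?_⟩
            cases b' with
            | false => simpa using hy
            | true => exact absurd ((hextend a (true :: z) (by simp)).2 ⟨y, by simpa using hy⟩) ht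
        obtain ⟨v, hv, hrun⟩ := ih (b :: z) (by simp; omega) ⟨y', hby⟩
        exact ⟨v, hv, (Runs.loopStep (by simp [put])
          (runs_searchStep_incomplete z w (fun h => hz ((hcomplete a z).1 h)) hb) hrun).mono
          (by rw [Nat.mul_add _ (k + 1) 1]; omega)⟩
  obtain ⟨v, hv, h3⟩ := loop M [] (by simp) ((hne a).imp fun y hy => by simpa using hy)
  have h1 : Runs O (Prog.push 0 false) (put [w, []]) (put [block [] ++ w, []]) 1 :=
    Runs.push (i := 0) (l := [w, []]) (by simp) false
  have h2 : Runs O (Prog.push 1 true) (put [block [] ++ w, []]) (put [block [] ++ w, [true]]) 1 :=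
    Runs.push (i := 1) (l := [block [] ++ w, []]) (by simp) true
  have h4 := hR (block v.reverse ++ w)
  rw [put_pad 1 (l := [block v.reverse ++ w]) (l' := [block v.reverse ++ w, []]) rfl] at h4
  simp only [hd_block_append, List.reverse_reverse, List.length_append, length_block,
    List.length_reverse] at h4
  have hv' : v.length ≤ M := hlen a v hv
  have hr := eval_mono r (show 2 * v.length + 1 + w.length ≤ 2 * M + 1 + w.length by omega)
  obtain ⟨t, ht, h⟩ := h1.seq (h2.seq (h3.seq h4))
  refine ⟨v, hv, put [v], t, ?_, ht.trans ?_, rfl⟩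
  · rw [initial_eq_put, put_pad 1 (l := [ea a]) (l' := [w, []]) rfl]
    exact h
  · have e : (C + 1) * (M + 1) + 1 =
        (18 * (2 * M + 1 + w.length) + 16) * (M + 1) + 1 := by rw [hC]
    rw [e]
    simp only [Polynomial.eval_add, Polynomial.eval_mul, Polynomial.eval_comp, Polynomial.eval_X,
      Polynomial.eval_ofNat, Polynomial.eval_one]
    rw [← hM]
    omega

end PH

namespace CQC

open PH

variable {D : Type*}

/-! ### Homomorphisms and cores of queries -/

/-- The terms of a query, in order of their occurrences. -/
def Query.adomList (q : Query D) : List (Term D) :=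
  q.summary.map Term.var ++ q.atoms.flatMap Atom.args ++ q.comps.flatMap (fun c => [c.lhs, c.rhs])

theorem Query.mem_adomList {q : Query D} {t : Term D} : t ∈ q.adomList ↔ t ∈ q.adom := by
  simp only [adomList, adom, List.mem_append, List.mem_map, List.mem_flatMap, Set.mem_ofPred_eq,
    List.mem_cons, List.not_mem_nil, or_false, or_assoc]
  simp only [eq_comm]

theorem Query.finite_adom (q : Query D) : q.adom.Finite :=
  q.adomList.finite_toSet.subset fun _ ht => Query.mem_adomList.2 ht

theorem Query.var_mem_adom {q : Query D} {x : Word} (hx : x ∈ q.summary) :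
    Term.var x ∈ q.adom := Or.inl ⟨x, hx, rfl⟩

theorem Query.arg_mem_adom {q : Query D} {a : Atom D} (ha : a ∈ q.atoms) {t : Term D}
    (ht : t ∈ a.args) : t ∈ q.adom := Or.inr (Or.inl ⟨a, ha, ht⟩)

theorem Query.lhs_mem_adom {q : Query D} {c : Comparison D} (hc : c ∈ q.comps) :
    c.lhs ∈ q.adom := Or.inr (Or.inr ⟨c, hc, Or.inl rfl⟩)

theorem Query.rhs_mem_adom {q : Query D} {c : Comparison D} (hc : c ∈ q.comps) :
    c.rhs ∈ q.adom := Or.inr (Or.inr ⟨c, hc, Or.inr rfl⟩)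

theorem holds_comap (L : Term D → Term D → Prop) (f : Term D → Term D) (r s : Term D) (op : Op) :
    Holds (fun r s => L (f r) (f s)) r op s ↔ Holds L (f r) op (f s) := by
  cases op <;> rfl

theorem map_eq_map_of_injOn {α β : Type*} {f : α → β} {S : Set α} (hf : Set.InjOn f S) :
    ∀ {l l' : List α}, (∀ t ∈ l, t ∈ S) → (∀ t ∈ l', t ∈ S) → l.map f = l'.map f → l = l'
  | [], [], _, _, _ => rfl
  | [], _ :: _, _, _, h => by simp at h
  | _ :: _, [], _, _, h => by simp at h
  | a :: l, b :: l', h1, h2, h => by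
    simp only [List.map_cons, List.cons.injEq] at h
    rw [hf (h1 a (by simp)) (h2 b (by simp)) h.1,
      map_eq_map_of_injOn hf (fun t ht => h1 t (by simp [ht])) (fun t ht => h2 t (by simp [ht]))
        h.2]

theorem image_eq_of_injOn_of_injOn {α β : Type*} {A : Set α} {B : Set β} (hA : A.Finite)
    (hB : B.Finite) {f : α → β} {g : β → α} (hf : Set.MapsTo f A B) (hfi : Set.InjOn f A)
    (hg : Set.MapsTo g B A) (hgi : Set.InjOn g B) : f '' A = B := by
  refine Set.eq_of_subset_of_ncard_le hf.image_subset ?_ hB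
  rw [hfi.ncard_image, ← hgi.ncard_image]
  exact Set.ncard_le_ncard hg.image_subset hA

section LinearOrder

variable [LinearOrder D] {q q₁ q₂ q₃ C C' : Query D} {f g : Term D → Term D}

/-- A linearization can be pulled back along a homomorphism. -/
theorem IsHom.isLinearization (h : IsHom q₁ q₂ f) {L : Term D → Term D → Prop}
    (hL : IsLinearization q₂ L) : IsLinearization q₁ (fun r s => L (f r) (f s)) where
  total r hr s hs := hL.total _ (h.mapsTo hr) _ (h.mapsTo hs)
  trans r hr s hs t ht := hL.trans _ (h.mapsTo hr) _ (h.mapsTo hs) _ (h.mapsTo ht)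
  const c d hc hd := by
    have hc' := h.mapsTo hc
    have hd' := h.mapsTo hd
    rw [h.const c hc] at hc'
    rw [h.const d hd] at hd'
    rw [h.const c hc, h.const d hd]
    exact hL.const c d hc' hd'
  comps c hc := (holds_comap L f _ _ _).2 (h.comps c hc L hL)

theorem IsHom.entails (h : IsHom q₁ q₂ f) {r s : Term D} {op : Op} (he : Entails q₁ r op s) :
    Entails q₂ (f r) op (f s) := fun L hL =>
  (holds_comap L f _ _ _).1 (he _ (h.isLinearization hL))

theorem IsHom.comp (hg : IsHom q₂ q₃ g) (hf : IsHom q₁ q₂ f) :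
    IsHom q₁ q₃ (fun t => g (f t)) where
  summary_eq := hf.summary_eq.trans hg.summary_eq
  mapsTo _ ht := hg.mapsTo (hf.mapsTo ht)
  summary x hx := by rw [hf.summary x hx, hg.summary x (hf.summary_eq ▸ hx)]
  const c hc := by
    have := hf.mapsTo hc
    rw [hf.const c hc] at this ⊢
    exact hg.const c this
  atoms a ha := by simpa [Function.comp_def] using hg.atoms _ (hf.atoms a ha)
  comps c hc := hg.entails (hf.comps c hc)

theorem entails_of_mem {c : Comparison D} (hc : c ∈ q.comps) : Entails q c.lhs c.op c.rhs :=
  fun _ hL => hL.comps c hc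

theorem IsHom.id (q : Query D) : IsHom q q (fun t => t) where
  summary_eq := rfl
  mapsTo _ ht := ht
  summary _ _ := rfl
  const _ _ := rfl
  atoms a ha := by simpa using ha
  comps _ hc := entails_of_mem hc

/-- All comparison symbols. -/
def ops : List Op := [Op.eq, Op.lt, Op.le]

theorem mem_ops (op : Op) : op ∈ ops := by cases op <;> simp [ops]

open Classical in
/-- The query induced by `q` on the terms in `S`, with all comparisons between them that `q`
entails. -/
noncomputable def Query.induced (q : Query D) (S : List (Term D)) : Query D where
  summary := q.summary
  atoms := q.atoms.filter (fun a => ∀ t ∈ a.args, t ∈ S)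
  comps := S.flatMap fun r => S.flatMap fun s => ops.flatMap fun op =>
    if Entails q r op s then [⟨r, op, s⟩] else []

theorem Query.mem_induced_atoms {S : List (Term D)} {a : Atom D} :
    a ∈ (q.induced S).atoms ↔ a ∈ q.atoms ∧ ∀ t ∈ a.args, t ∈ S := by
  simp [induced]

theorem Query.mem_induced_comps {S : List (Term D)} {c : Comparison D} :
    c ∈ (q.induced S).comps ↔ c.lhs ∈ S ∧ c.rhs ∈ S ∧ Entails q c.lhs c.op c.rhs := by
  classical
  obtain ⟨r, op, s⟩ := c
  simp only [induced, List.mem_flatMap, List.mem_ite_nil_right, List.mem_singleton,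
    Comparison.mk.injEq]
  constructor
  · rintro ⟨r', hr, s', hs, op', -, h, rfl, rfl, rfl⟩
    exact ⟨hr, hs, h⟩
  · rintro ⟨hr, hs, h⟩
    exact ⟨r, hr, s, hs, op, mem_ops op, h, rfl, rfl, rfl⟩

theorem Query.mem_induced_adom {S : List (Term D)} (hS : ∀ t ∈ S, t ∈ q.adom)
    (hsum : ∀ x ∈ q.summary, Term.var x ∈ S) {t : Term D} : t ∈ (q.induced S).adom ↔ t ∈ S := by
  constructor
  · rintro (⟨x, hx, rfl⟩ | ⟨a, ha, ht⟩ | ⟨c, hc, rfl | rfl⟩)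
    · exact hsum x hx
    · exact (mem_induced_atoms.1 ha).2 t ht
    · exact (mem_induced_comps.1 hc).1
    · exact (mem_induced_comps.1 hc).2.1
  · intro ht
    refine Query.lhs_mem_adom (c := ⟨t, Op.eq, t⟩) (mem_induced_comps.2 ⟨ht, ht, fun L hL => ?_⟩)
    have := hL.total t (hS t ht) t (hS t ht)
    exact ⟨this.elim _root_.id _root_.id, this.elim _root_.id _root_.id⟩

/-- The image of an endomorphism `f` induces a core if all endomorphisms are injective on it. -/
theorem isCore_induced (hf : IsHom q q f) (hinj : ∀ g, IsHom q q g →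
      ∀ r ∈ q.adom, ∀ s ∈ q.adom, g (f r) = g (f s) → f r = f s) :
    IsCore q (q.induced (q.adomList.map f)) := by
  set S := q.adomList.map f with hSdef
  have hmem : ∀ t, t ∈ S ↔ ∃ r ∈ q.adom, f r = t := by
    simp [hSdef, Query.mem_adomList]
  have hS : ∀ t ∈ S, t ∈ q.adom := by
    intro t ht
    obtain ⟨r, hr, rfl⟩ := (hmem t).1 ht
    exact hf.mapsTo hr
  have hsum : ∀ x ∈ q.summary, Term.var x ∈ S := fun x hx =>
    (hmem _).2 ⟨_, Query.var_mem_adom hx, hf.summary x hx⟩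
  have hadom : ∀ t, t ∈ (q.induced S).adom ↔ t ∈ S := fun t => Query.mem_induced_adom hS hsum
  have hincl : IsHom (q.induced S) q (fun t => t) :=
    { summary_eq := rfl
      mapsTo := fun t ht => hS t ((hadom t).1 ht)
      summary := fun _ _ => rfl
      const := fun _ _ => rfl
      atoms := fun a ha => by simpa using (Query.mem_induced_atoms.1 ha).1
      comps := fun c hc => (Query.mem_induced_comps.1 hc).2.2 }
  refine ⟨⟨f, rfl, fun t ht => (hadom _).2 ((hmem _).2 ⟨t, ht, rfl⟩), hf.summary, hf.const,
    fun a ha => ?_, fun c hc => ?_⟩, ?_, ⟨rfl, fun _ => Iff.rfl, fun c => ⟨fun hc => ?_, ?_⟩⟩⟩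
  · refine Query.mem_induced_atoms.2 ⟨hf.atoms a ha, fun t ht => ?_⟩
    obtain ⟨r, hr, rfl⟩ := List.mem_map.1 ht
    exact (hmem _).2 ⟨r, Query.arg_mem_adom ha hr, rfl⟩
  · exact entails_of_mem (c := ⟨f c.lhs, c.op, f c.rhs⟩) (Query.mem_induced_comps.2
      ⟨(hmem _).2 ⟨_, Query.lhs_mem_adom hc, rfl⟩, (hmem _).2 ⟨_, Query.rhs_mem_adom hc, rfl⟩,
        hf.comps c hc⟩)
  · rintro q'' ⟨k, hk⟩ ⟨k', hk'⟩
    refine ⟨_, hk.comp hincl, fun r hr s hs hrs => ?_⟩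
    obtain ⟨r', hr', rfl⟩ := (hmem r).1 ((hadom r).1 hr)
    obtain ⟨s', hs', rfl⟩ := (hmem s).1 ((hadom s).1 hs)
    exact hinj _ (hk'.comp hk) r' hr' s' hs' (congrArg k' hrs)
  · exact ⟨Query.lhs_mem_adom hc, Query.rhs_mem_adom hc, entails_of_mem hc⟩
  · rintro ⟨hl, hr, h⟩
    exact Query.mem_induced_comps.2 ⟨(hadom _).1 hl, (hadom _).1 hr, hincl.entails h⟩

/-- An endomorphism with the least possible number of values is as required in `isCore_induced`. -/
theorem exists_isHom_injOn_image (q : Query D) : ∃ f, IsHom q q f ∧ ∀ g, IsHom q q g →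
    ∀ r ∈ q.adom, ∀ s ∈ q.adom, g (f r) = g (f s) → f r = f s := by
  classical
  have hex : ∃ n, ∃ f, IsHom q q f ∧ (f '' q.adom).ncard = n := ⟨_, _, IsHom.id q, rfl⟩
  obtain ⟨f, hf, hn⟩ := Nat.find_spec hex
  refine ⟨f, hf, fun g hg r hr s hs hrs => ?_⟩
  have hfin : (f '' q.adom).Finite := q.finite_adom.image f
  have hle : (f '' q.adom).ncard ≤ (g '' (f '' q.adom)).ncard := by
    rw [hn]
    exact Nat.find_min' hex ⟨_, hg.comp hf, by rw [Set.image_image]⟩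
  have hinj : Set.InjOn g (f '' q.adom) :=
    (Set.ncard_image_iff hfin).1 (le_antisymm (Set.ncard_image_le hfin) hle)
  exact hinj ⟨r, hr, rfl⟩ ⟨s, hs, rfl⟩ hrs

/-- A core is unique up to isomorphism: between two cores there are injective homomorphisms in both
directions, which by counting are isomorphisms. -/
theorem IsCore.isomorphic (hC : IsCore q C) (hC' : IsCore q C') : Isomorphic C C' := by
  have back : ∀ {C : Query D}, IsCore q C → HomTo C q := fun hC =>
    let ⟨h, hh, _⟩ := hC.injective q ⟨_, IsHom.id q⟩ ⟨_, IsHom.id q⟩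
    ⟨h, hh⟩
  have finA : ∀ C : Query D, {a | a ∈ C.atoms}.Finite := fun C => C.atoms.finite_toSet
  have finC : ∀ C : Query D, {c | c ∈ C.comps}.Finite := fun C => C.comps.finite_toSet
  let mapA : (Term D → Term D) → Atom D → Atom D := fun h x => ⟨x.rel, x.args.map h⟩
  let mapC : (Term D → Term D) → Comparison D → Comparison D :=
    fun h c => ⟨h c.lhs, c.op, h c.rhs⟩
  have injA : ∀ {C : Query D} {h : Term D → Term D}, Set.InjOn h C.adom →
      Set.InjOn (mapA h) {x | x ∈ C.atoms} := by
    rintro C h hi ⟨R, z⟩ hx ⟨R', z'⟩ hx' he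
    simp only [mapA, Atom.mk.injEq] at he
    exact congrArg₂ Atom.mk he.1 (map_eq_map_of_injOn hi
      (fun t ht => Query.arg_mem_adom (show _ ∈ C.atoms from hx) ht)
      (fun t ht => Query.arg_mem_adom (show _ ∈ C.atoms from hx') ht) he.2)
  have injC : ∀ {C : Query D} {h : Term D → Term D}, Set.InjOn h C.adom →
      Set.InjOn (mapC h) {x | x ∈ C.comps} := by
    rintro C h hi ⟨r, op, s⟩ hx ⟨r', op', s'⟩ hx' he
    simp only [mapC, Comparison.mk.injEq] at he
    obtain ⟨h1, rfl, h2⟩ := he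
    have hl : r = r' := hi (Query.lhs_mem_adom hx) (Query.lhs_mem_adom hx') h1
    have hr : s = s' := hi (Query.rhs_mem_adom hx) (Query.rhs_mem_adom hx') h2
    rw [hl, hr]
  have mapsC : ∀ {C C' : Query D} {h : Term D → Term D}, IsExtension C' C' → IsHom C C' h →
      Set.MapsTo (mapC h) {x | x ∈ C.comps} {x | x ∈ C'.comps} := fun he hh c hc =>
    (he.comps _).2 ⟨hh.mapsTo (Query.lhs_mem_adom hc), hh.mapsTo (Query.rhs_mem_adom hc),
      hh.comps c hc⟩
  obtain ⟨a, ha, hai⟩ := hC.injective C' hC'.hom (back hC')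
  obtain ⟨b, hb, hbi⟩ := hC'.injective C hC.hom (back hC)
  have imA := image_eq_of_injOn_of_injOn (finA C) (finA C') (f := mapA a) (g := mapA b)
    (fun x hx => ha.atoms x hx) (injA hai) (fun x hx => hb.atoms x hx) (injA hbi)
  have imC := image_eq_of_injOn_of_injOn (finC C) (finC C') (mapsC hC'.extended ha) (injC hai)
    (mapsC hC.extended hb) (injC hbi)
  have im := image_eq_of_injOn_of_injOn C.finite_adom C'.finite_adom ha.mapsTo hai hb.mapsTo hbi
  refine ⟨ha.summary_eq, a, ⟨ha.mapsTo, hai, im.ge⟩, ha.summary, ha.const, fun R z hz =>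
    ⟨fun h => ha.atoms _ h, fun h => ?_⟩, fun r hr s hs op =>
    ⟨fun h => mapsC hC'.extended ha h, fun h => ?_⟩⟩
  · obtain ⟨⟨R', z'⟩, hx, he⟩ := imA.ge h
    simp only [mapA, Atom.mk.injEq] at he
    rwa [← he.1, ← map_eq_map_of_injOn hai (fun t ht => Query.arg_mem_adom hx ht) hz he.2]
  · obtain ⟨⟨r', op', s'⟩, hx, he⟩ := imC.ge h
    simp only [mapC, Comparison.mk.injEq] at he
    rwa [← he.2.1, ← hai (Query.lhs_mem_adom hx) hr he.1, ← hai (Query.rhs_mem_adom hx) hs he.2.2]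

end LinearOrder

theorem Isomorphic.trans {q₁ q₂ q₃ : Query D} (h : Isomorphic q₁ q₂) (h' : Isomorphic q₂ q₃) :
    Isomorphic q₁ q₃ := by
  obtain ⟨hs, f, hf, hsum, hconst, hA, hC⟩ := h
  obtain ⟨hs', g, hg, hsum', hconst', hA', hC'⟩ := h'
  refine ⟨hs.trans hs', fun t => g (f t), hg.comp hf, fun x hx => ?_, fun c hc => ?_,
    fun R z hz => ?_, fun r hr s hs op => ?_⟩
  · beta_reduce
    rw [hsum x hx, hsum' x (hs ▸ hx)]
  · have := hf.mapsTo hc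
    beta_reduce
    rw [hconst c hc] at this ⊢
    exact hconst' c this
  · rw [hA R z hz, hA' R (z.map f) (by simpa using fun t ht => hf.mapsTo (hz t ht))]
    simp [Function.comp_def]
  · rw [hC r hr s hs op, hC' _ (hf.mapsTo hr) _ (hf.mapsTo hs) op]

/-! ### Certificates as words -/

/-! Certificates and their tests are formulated for arbitrary words; `w`, `w₁`, `w₂` stand for the
encodings of queries. -/

/-- The word `h`, read as a finite function: a sequence of entries, each of which consists of the
block of an argument followed by the value there. The value is empty for other arguments. -/
def app (h t : Word) : Word := (untuple h).flatMap (fun e => if hd e = t then tl e else [])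

/-- The image of an encoded atom under the finite function `h`. -/
def mapAtom (h a : Word) : Word :=
  block (hd a) ++ (untuple (tl a)).flatMap (fun t => block (app h t))

/-- The sequence of the atoms of an encoded query. -/
def atomsWord (w : Word) : Word := hd (tl w)

/-- The sequence of the comparisons of an encoded query. -/
def compsWord (w : Word) : Word := hd (tl (tl w))

/-- The sequence of the terms of an encoded query. -/
def adomWord (w : Word) : Word :=
  (untuple (hd w)).flatMap (fun x => block (true :: x)) ++
    ((untuple (atomsWord w)).flatMap (fun a => tl a) ++
      (untuple (compsWord w)).flatMap (fun c => tl c))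

/-- The sequence of the comparison symbols. -/
def opsWord : Word := tuple (ops.map encOp)

/-- The encoding of a comparison with the symbol `op` between `r` and `s`. -/
def compWord (op r s : Word) : Word := block op ++ (block r ++ block s)

/-- The finite function `L` is read as a ranking: a term is at most another one if its value is not
longer. This makes `L` a total preorder, whatever word it is. -/
def RankLE (L r s : Word) : Prop := (app L r).length ≤ (app L s).length

/-- The comparison `r op s` holds in the ranking `L`. -/
def RankHolds (L op r s : Word) : Prop :=
  RankLE L r s ∧ (op = encOp Op.eq → RankLE L s r) ∧ (op = encOp Op.lt → ¬ RankLE L s r)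

/-- The encoding of a constant. -/
def IsConst (t : Word) : Prop := t = false :: t.tail

/-- The ranking `L` is a linearization of the query, where `R` is the order of the constants. -/
def RankLinearizes (R : Set Word) (w L : Word) : Prop :=
  (∀ c ∈ untuple (compsWord w), RankHolds L (hd c) (hd (tl c)) (hd (tl (tl c)))) ∧
  ∀ r ∈ untuple (adomWord w), ∀ s ∈ untuple (adomWord w), IsConst r → IsConst s →
    (RankLE L r s ↔ block r.tail ++ block s.tail ∈ R)

/-- The comparison `r op s` holds in all rankings of the sequence `F`. -/
def AllHold (F op r s : Word) : Prop := ∀ L ∈ untuple F, RankHolds L op r s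

/-- The finite function `h` satisfies all the conditions on a homomorphism but the one on
comparisons. -/
def MapsAtoms (w₁ w₂ h : Word) : Prop :=
  hd w₁ = hd w₂ ∧
  (∀ t ∈ untuple (adomWord w₁), app h t ∈ untuple (adomWord w₂)) ∧
  (∀ x ∈ untuple (hd w₁), app h (true :: x) = true :: x) ∧
  (∀ t ∈ untuple (adomWord w₁), IsConst t → app h t = t) ∧
  ∀ a ∈ untuple (atomsWord w₁), mapAtom h a ∈ untuple (atomsWord w₂)

/-- The finite function `h` is an endomorphism of the query, if entailment is understood as
holding in all rankings of `F`. -/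
def MapsComps (w h F : Word) : Prop :=
  MapsAtoms w w h ∧ ∀ c ∈ untuple (compsWord w),
    AllHold F (hd c) (app h (hd (tl c))) (app h (hd (tl (tl c))))

/-- The test that `h` and `F` describe a core of the query: `F` consists of linearizations, and what
holds in all of them holds in the linearization `L`, too; `h` is an endomorphism, and the
endomorphism `g` is injective on its image. The test is to be passed for all `g` and `L`. -/
def CoreTest (R : Set Word) (w h F g L : Word) : Prop :=
  MapsComps w h F ∧ (∀ L' ∈ untuple F, RankLinearizes R w L') ∧
  (RankLinearizes R w L → ∀ r ∈ untuple (adomWord w), ∀ s ∈ untuple (adomWord w),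
    ∀ op ∈ untuple opsWord, AllHold F op r s → RankHolds L op r s) ∧
  (MapsComps w g F → ∀ r ∈ untuple (adomWord w), ∀ s ∈ untuple (adomWord w),
    app g (app h r) = app g (app h s) → app h r = app h s)

/-- The image of the finite function `h`. -/
def imageWord (w h : Word) : Word := (untuple (adomWord w)).flatMap (fun t => block (app h t))

open Classical in
/-- The encoding of the query induced on the image of `h`, if `F` describes entailment. -/
noncomputable def inducedWord (w h F : Word) : Word :=
  block (hd w) ++ (block ((untuple (atomsWord w)).flatMap (fun a =>
    if ∀ t ∈ untuple (tl a), t ∈ untuple (imageWord w h) then block a else [])) ++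
  block ((untuple (imageWord w h)).flatMap fun r => (untuple (imageWord w h)).flatMap fun s =>
    (untuple opsWord).flatMap fun op =>
      if AllHold F op r s then block (compWord op r s) else []))

/-- The test that the finite function `h` is an isomorphism. -/
def IsoTest (w₁ w₂ h : Word) : Prop :=
  MapsAtoms w₁ w₂ h ∧
  (∀ t ∈ untuple (adomWord w₂), ∃ r ∈ untuple (adomWord w₁), app h r = t) ∧
  (∀ r ∈ untuple (adomWord w₁), ∀ s ∈ untuple (adomWord w₁), app h r = app h s → r = s) ∧
  (∀ b ∈ untuple (atomsWord w₂), ∃ a ∈ untuple (atomsWord w₁), mapAtom h a = b) ∧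
  ∀ r ∈ untuple (adomWord w₁), ∀ s ∈ untuple (adomWord w₁), ∀ op ∈ untuple opsWord,
    (compWord op r s ∈ untuple (compsWord w₁) ↔
      compWord op (app h r) (app h s) ∈ untuple (compsWord w₂))

/-! ### The tests take polynomial time -/

section PolyTime

variable {O : Set Word} {w w₁ w₂ h t a L op r s F g : Word → Word}

theorem polyFun_comp_tl (hf : PolyFun O w) : PolyFun O (fun v => w (tl v)) := hf.comp PolyFun.tl

theorem polyFun_app (hh : PolyFun O h) (ht : PolyFun O t) :
    PolyFun O (fun v => app (h v) (t v)) :=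
  hh.flatMap (F := fun e v => if hd e = t v then tl e else [])
    (PolyDec.ite (PolyDec.eq (PolyFun.hd.comp PolyFun.hd) (polyFun_comp_tl ht))
      (PolyFun.tl.comp PolyFun.hd) (PolyFun.const []))

theorem polyFun_mapAtom (hh : PolyFun O h) (ha : PolyFun O a) :
    PolyFun O (fun v => mapAtom (h v) (a v)) :=
  (PolyFun.block.comp (PolyFun.hd.comp ha)).append
    ((PolyFun.tl.comp ha).flatMap (F := fun e v => block (app (h v) e))
      (PolyFun.block.comp (polyFun_app (polyFun_comp_tl hh) PolyFun.hd)))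

theorem polyFun_atomsWord (hw : PolyFun O w) : PolyFun O (fun v => atomsWord (w v)) :=
  PolyFun.hd.comp (PolyFun.tl.comp hw)

theorem polyFun_compsWord (hw : PolyFun O w) : PolyFun O (fun v => compsWord (w v)) :=
  PolyFun.hd.comp (PolyFun.tl.comp (PolyFun.tl.comp hw))

theorem polyFun_adomWord (hw : PolyFun O w) : PolyFun O (fun v => adomWord (w v)) :=
  ((PolyFun.hd.comp hw).flatMap (F := fun x _ => block (true :: x))
    (PolyFun.block.comp ((PolyFun.const [true]).append PolyFun.hd))).append
  (((polyFun_atomsWord hw).flatMap (F := fun x _ => tl x) (PolyFun.tl.comp PolyFun.hd)).append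
    ((polyFun_compsWord hw).flatMap (F := fun x _ => tl x) (PolyFun.tl.comp PolyFun.hd)))

theorem polyFun_compWord (ho : PolyFun O op) (hr : PolyFun O r) (hs : PolyFun O s) :
    PolyFun O (fun v => compWord (op v) (r v) (s v)) :=
  (PolyFun.block.comp ho).append ((PolyFun.block.comp hr).append (PolyFun.block.comp hs))

theorem polyDec_rankLE (hL : PolyFun O L) (hr : PolyFun O r) (hs : PolyFun O s) :
    PolyDec O (fun v => RankLE (L v) (r v) (s v)) :=
  PolyDec.length_le (polyFun_app hL hr) (polyFun_app hL hs)

theorem polyDec_rankHolds (hL : PolyFun O L) (ho : PolyFun O op) (hr : PolyFun O r)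
    (hs : PolyFun O s) : PolyDec O (fun v => RankHolds (L v) (op v) (r v) (s v)) :=
  (polyDec_rankLE hL hr hs).and
    (((PolyDec.eq ho (PolyFun.const _)).imp (polyDec_rankLE hL hs hr)).and
      ((PolyDec.eq ho (PolyFun.const _)).imp (polyDec_rankLE hL hs hr).not))

theorem polyDec_isConst (ht : PolyFun O t) : PolyDec O (fun v => IsConst (t v)) :=
  PolyDec.eq ht ((PolyFun.const [false]).append (PolyFun.tail.comp ht))

/-- The first three entries of a sequence of words. -/
theorem polyFun_entries (ha : PolyFun O a) : PolyFun O (fun v => hd (a v)) ∧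
    PolyFun O (fun v => hd (tl (a v))) ∧ PolyFun O (fun v => hd (tl (tl (a v)))) :=
  ⟨PolyFun.hd.comp ha, PolyFun.hd.comp (PolyFun.tl.comp ha),
    PolyFun.hd.comp (PolyFun.tl.comp (PolyFun.tl.comp ha))⟩

theorem polyDec_forall_adom {p : Word → Word → Prop} (hw : PolyFun O w)
    (hp : PolyDec O (fun v => p (hd v) (tl v))) :
    PolyDec O (fun v => ∀ r ∈ untuple (adomWord (w v)), p r v) :=
  PolyDec.forall_mem (polyFun_adomWord hw) hp

theorem polyDec_rankLinearizes {R : Set Word} (hR : PolyDec O (fun v => v ∈ R))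
    (hw : PolyFun O w) (hL : PolyFun O L) :
    PolyDec O (fun v => RankLinearizes R (w v) (L v)) := by
  have e := polyFun_entries (PolyFun.hd (O := O))
  refine (PolyDec.forall_mem
    (p := fun c v => RankHolds (L v) (hd c) (hd (tl c)) (hd (tl (tl c)))) (polyFun_compsWord hw)
    (polyDec_rankHolds (polyFun_comp_tl hL) e.1 e.2.1 e.2.2)).and ?_
  refine polyDec_forall_adom (p := fun r v => ∀ s ∈ untuple (adomWord (w v)), IsConst r →
    IsConst s → (RankLE (L v) r s ↔ block r.tail ++ block s.tail ∈ R)) hw ?_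
  refine polyDec_forall_adom (p := fun s v => IsConst (hd v) → IsConst s →
    (RankLE (L (tl v)) (hd v) s ↔ block (hd v).tail ++ block s.tail ∈ R)) (polyFun_comp_tl hw) ?_
  have hr : PolyFun O (fun v => hd (tl v)) := polyFun_comp_tl PolyFun.hd
  exact (polyDec_isConst hr).imp ((polyDec_isConst PolyFun.hd).imp
    ((polyDec_rankLE (polyFun_comp_tl (polyFun_comp_tl hL)) hr PolyFun.hd).iff
      (hR.comp ((PolyFun.block.comp (PolyFun.tail.comp hr)).append
        (PolyFun.block.comp (PolyFun.tail.comp PolyFun.hd))))))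

theorem polyDec_allHold (hF : PolyFun O F) (ho : PolyFun O op) (hr : PolyFun O r)
    (hs : PolyFun O s) : PolyDec O (fun v => AllHold (F v) (op v) (r v) (s v)) :=
  PolyDec.forall_mem (p := fun L v => RankHolds L (op v) (r v) (s v)) hF
    (polyDec_rankHolds PolyFun.hd (polyFun_comp_tl ho) (polyFun_comp_tl hr) (polyFun_comp_tl hs))

theorem polyDec_mapsAtoms (hw₁ : PolyFun O w₁) (hw₂ : PolyFun O w₂) (hh : PolyFun O h) :
    PolyDec O (fun v => MapsAtoms (w₁ v) (w₂ v) (h v)) := by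
  have hh' := polyFun_comp_tl hh
  have hx : PolyFun O (fun v => true :: hd v) := (PolyFun.const [true]).append PolyFun.hd
  exact (PolyDec.eq (PolyFun.hd.comp hw₁) (PolyFun.hd.comp hw₂)).and
    ((polyDec_forall_adom (p := fun t v => app (h v) t ∈ untuple (adomWord (w₂ v))) hw₁
      (PolyDec.mem (polyFun_app hh' PolyFun.hd)
        (polyFun_adomWord (polyFun_comp_tl hw₂)))).and
    ((PolyDec.forall_mem (p := fun x v => app (h v) (true :: x) = true :: x) (PolyFun.hd.comp hw₁)
      (PolyDec.eq (polyFun_app hh' hx) hx)).and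
    ((polyDec_forall_adom (p := fun t v => IsConst t → app (h v) t = t) hw₁
      ((polyDec_isConst PolyFun.hd).imp (PolyDec.eq (polyFun_app hh' PolyFun.hd) PolyFun.hd))).and
    (PolyDec.forall_mem (p := fun a v => mapAtom (h v) a ∈ untuple (atomsWord (w₂ v)))
      (polyFun_atomsWord hw₁) (PolyDec.mem (polyFun_mapAtom hh' PolyFun.hd)
        (polyFun_atomsWord (polyFun_comp_tl hw₂)))))))

theorem polyDec_mapsComps (hw : PolyFun O w) (hh : PolyFun O h) (hF : PolyFun O F) :
    PolyDec O (fun v => MapsComps (w v) (h v) (F v)) := by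
  have e := polyFun_entries (PolyFun.hd (O := O))
  have hh' := polyFun_comp_tl hh
  exact (polyDec_mapsAtoms hw hw hh).and (PolyDec.forall_mem
    (p := fun c v => AllHold (F v) (hd c) (app (h v) (hd (tl c))) (app (h v) (hd (tl (tl c)))))
    (polyFun_compsWord hw) (polyDec_allHold (polyFun_comp_tl hF) e.1 (polyFun_app hh' e.2.1)
      (polyFun_app hh' e.2.2)))

theorem polyDec_coreTest {R : Set Word} (hR : PolyDec O (fun v => v ∈ R)) (hw : PolyFun O w)
    (hh : PolyFun O h) (hF : PolyFun O F) (hg : PolyFun O g) (hL : PolyFun O L) :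
    PolyDec O (fun v => CoreTest R (w v) (h v) (F v) (g v) (L v)) := by
  have hr : PolyFun O (fun v => hd (tl v)) := polyFun_comp_tl PolyFun.hd
  refine (polyDec_mapsComps hw hh hF).and ((PolyDec.forall_mem
    (p := fun L' v => RankLinearizes R (w v) L') hF
    (polyDec_rankLinearizes hR (polyFun_comp_tl hw) PolyFun.hd)).and
    (((polyDec_rankLinearizes hR hw hL).imp ?_).and ((polyDec_mapsComps hw hg hF).imp ?_)))
  · refine polyDec_forall_adom (p := fun r v => ∀ s ∈ untuple (adomWord (w v)),
      ∀ op ∈ untuple opsWord, AllHold (F v) op r s → RankHolds (L v) op r s) hw ?_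
    refine polyDec_forall_adom (p := fun s v => ∀ op ∈ untuple opsWord,
      AllHold (F (tl v)) op (hd v) s → RankHolds (L (tl v)) op (hd v) s) (polyFun_comp_tl hw) ?_
    refine PolyDec.forall_mem (p := fun op v => AllHold (F (tl (tl v))) op (hd (tl v)) (hd v) →
      RankHolds (L (tl (tl v))) op (hd (tl v)) (hd v)) (PolyFun.const _) ?_
    have hF' := polyFun_comp_tl (polyFun_comp_tl (polyFun_comp_tl hF))
    have hL' := polyFun_comp_tl (polyFun_comp_tl (polyFun_comp_tl hL))
    exact (polyDec_allHold hF' PolyFun.hd (polyFun_comp_tl hr) hr).imp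
      (polyDec_rankHolds hL' PolyFun.hd (polyFun_comp_tl hr) hr)
  · refine polyDec_forall_adom (p := fun r v => ∀ s ∈ untuple (adomWord (w v)),
      app (g v) (app (h v) r) = app (g v) (app (h v) s) → app (h v) r = app (h v) s) hw ?_
    refine polyDec_forall_adom (p := fun s v => app (g (tl v)) (app (h (tl v)) (hd v)) =
      app (g (tl v)) (app (h (tl v)) s) → app (h (tl v)) (hd v) = app (h (tl v)) s)
      (polyFun_comp_tl hw) ?_
    have hh' := polyFun_comp_tl (polyFun_comp_tl hh)
    have hg' := polyFun_comp_tl (polyFun_comp_tl hg)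
    have h1 := polyFun_app hh' hr
    have h2 := polyFun_app hh' PolyFun.hd
    exact (PolyDec.eq (polyFun_app hg' h1) (polyFun_app hg' h2)).imp (PolyDec.eq h1 h2)

theorem polyFun_imageWord (hw : PolyFun O w) (hh : PolyFun O h) :
    PolyFun O (fun v => imageWord (w v) (h v)) :=
  (polyFun_adomWord hw).flatMap (F := fun t v => block (app (h v) t))
    (PolyFun.block.comp (polyFun_app (polyFun_comp_tl hh) PolyFun.hd))

open Classical in
theorem polyFun_inducedWord (hw : PolyFun O w) (hh : PolyFun O h) (hF : PolyFun O F) :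
    PolyFun O (fun v => inducedWord (w v) (h v) (F v)) := by
  have him := polyFun_imageWord hw hh
  have hr : PolyFun O (fun v => hd (tl v)) := polyFun_comp_tl PolyFun.hd
  refine (PolyFun.block.comp (PolyFun.hd.comp hw)).append ((PolyFun.block.comp ?_).append
    (PolyFun.block.comp ?_))
  · refine (polyFun_atomsWord hw).flatMap (F := fun a v => if ∀ t ∈ untuple (tl a),
      t ∈ untuple (imageWord (w v) (h v)) then block a else []) ?_
    exact PolyDec.ite (PolyDec.forall_mem
      (p := fun t v => t ∈ untuple (imageWord (w (tl v)) (h (tl v)))) (PolyFun.tl.comp PolyFun.hd)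
      (PolyDec.mem PolyFun.hd (polyFun_comp_tl (polyFun_comp_tl him))))
      (PolyFun.block.comp PolyFun.hd) (PolyFun.const [])
  · refine him.flatMap (F := fun r v => (untuple (imageWord (w v) (h v))).flatMap fun s =>
      (untuple opsWord).flatMap fun op =>
        if AllHold (F v) op r s then block (compWord op r s) else []) ?_
    refine (polyFun_comp_tl him).flatMap (F := fun s v => (untuple opsWord).flatMap fun op =>
      if AllHold (F (tl v)) op (hd v) s then block (compWord op (hd v) s) else []) ?_
    refine (PolyFun.const opsWord).flatMap (F := fun op v =>
      if AllHold (F (tl (tl v))) op (hd (tl v)) (hd v) then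
        block (compWord op (hd (tl v)) (hd v)) else []) ?_
    have hF' := polyFun_comp_tl (polyFun_comp_tl (polyFun_comp_tl hF))
    exact PolyDec.ite (polyDec_allHold hF' PolyFun.hd (polyFun_comp_tl hr) hr)
      (PolyFun.block.comp (polyFun_compWord PolyFun.hd (polyFun_comp_tl hr) hr))
      (PolyFun.const [])

theorem polyDec_isoTest (hw₁ : PolyFun O w₁) (hw₂ : PolyFun O w₂) (hh : PolyFun O h) :
    PolyDec O (fun v => IsoTest (w₁ v) (w₂ v) (h v)) := by
  have hr : PolyFun O (fun v => hd (tl v)) := polyFun_comp_tl PolyFun.hd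
  have hh' := polyFun_comp_tl (polyFun_comp_tl hh)
  refine (polyDec_mapsAtoms hw₁ hw₂ hh).and (PolyDec.and ?_ (PolyDec.and ?_ (PolyDec.and ?_ ?_)))
  · refine polyDec_forall_adom
      (p := fun t v => ∃ r ∈ untuple (adomWord (w₁ v)), app (h v) r = t) hw₂ ?_
    exact PolyDec.exists_mem (p := fun r v => app (h (tl v)) r = hd v)
      (polyFun_adomWord (polyFun_comp_tl hw₁)) (PolyDec.eq (polyFun_app hh' PolyFun.hd) hr)
  · refine polyDec_forall_adom (p := fun r v => ∀ s ∈ untuple (adomWord (w₁ v)),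
      app (h v) r = app (h v) s → r = s) hw₁ ?_
    refine polyDec_forall_adom (p := fun s v => app (h (tl v)) (hd v) = app (h (tl v)) s →
      hd v = s) (polyFun_comp_tl hw₁) ?_
    exact (PolyDec.eq (polyFun_app hh' hr) (polyFun_app hh' PolyFun.hd)).imp
      (PolyDec.eq hr PolyFun.hd)
  · refine PolyDec.forall_mem
      (p := fun b v => ∃ a ∈ untuple (atomsWord (w₁ v)), mapAtom (h v) a = b)
      (polyFun_atomsWord hw₂) ?_
    exact PolyDec.exists_mem (p := fun a v => mapAtom (h (tl v)) a = hd v)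
      (polyFun_atomsWord (polyFun_comp_tl hw₁)) (PolyDec.eq (polyFun_mapAtom hh' PolyFun.hd) hr)
  · refine polyDec_forall_adom (p := fun r v => ∀ s ∈ untuple (adomWord (w₁ v)),
      ∀ op ∈ untuple opsWord, (compWord op r s ∈ untuple (compsWord (w₁ v)) ↔
        compWord op (app (h v) r) (app (h v) s) ∈ untuple (compsWord (w₂ v)))) hw₁ ?_
    refine polyDec_forall_adom (p := fun s v => ∀ op ∈ untuple opsWord,
      (compWord op (hd v) s ∈ untuple (compsWord (w₁ (tl v))) ↔
        compWord op (app (h (tl v)) (hd v)) (app (h (tl v)) s) ∈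
          untuple (compsWord (w₂ (tl v))))) (polyFun_comp_tl hw₁) ?_
    refine PolyDec.forall_mem (p := fun op v =>
      (compWord op (hd (tl v)) (hd v) ∈ untuple (compsWord (w₁ (tl (tl v)))) ↔
        compWord op (app (h (tl (tl v))) (hd (tl v))) (app (h (tl (tl v))) (hd v)) ∈
          untuple (compsWord (w₂ (tl (tl v)))))) (PolyFun.const opsWord) ?_
    have h3 := polyFun_comp_tl hh'
    have hr' := polyFun_comp_tl hr
    exact (PolyDec.mem (polyFun_compWord PolyFun.hd hr' hr) (polyFun_compsWord
      (polyFun_comp_tl (polyFun_comp_tl (polyFun_comp_tl hw₁))))).iff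
      (PolyDec.mem (polyFun_compWord PolyFun.hd (polyFun_app h3 hr') (polyFun_app h3 hr))
        (polyFun_compsWord (polyFun_comp_tl (polyFun_comp_tl (polyFun_comp_tl hw₂)))))

end PolyTime

variable {code : D → Word}

/-! ### The words and the queries that they encode -/

theorem encTerm_injective (hcode : Function.Injective code) :
    Function.Injective (encTerm code) := by
  rintro (c | x) (d | y) h
  · rw [hcode (List.cons.inj h).2]
  · simp [encTerm] at h
  · simp [encTerm] at h
  · rw [(List.cons.inj h).2]

theorem tuple_injective : Function.Injective tuple := fun l l' h => by
  rw [← untuple_tuple l, h, untuple_tuple]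

theorem encAtom_injective (hcode : Function.Injective code) :
    Function.Injective (encAtom code) := by
  rintro ⟨R, z⟩ ⟨R', z'⟩ h
  obtain ⟨h1, h2⟩ := List.cons.inj (tuple_injective h)
  exact congrArg₂ Atom.mk h1 ((encTerm_injective hcode).list_map h2)

theorem encOp_injective : Function.Injective encOp := by
  intro op op' h
  cases op <;> cases op' <;> simp_all [encOp]

theorem encComparison_injective (hcode : Function.Injective code) :
    Function.Injective (encComparison code) := by
  rintro ⟨r, op, s⟩ ⟨r', op', s'⟩ h
  have h' := tuple_injective h
  simp only [List.cons.injEq, and_true] at h'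
  rw [encOp_injective h'.1, encTerm_injective hcode h'.2.1, encTerm_injective hcode h'.2.2]

theorem isConst_encTerm {t : Term D} : IsConst (encTerm code t) ↔ ∃ c, t = Term.const c := by
  cases t <;> simp [IsConst, encTerm]

theorem compWord_eq (r s : Term D) (op : Op) :
    compWord (encOp op) (encTerm code r) (encTerm code s) = encComparison code ⟨r, op, s⟩ := by
  simp [compWord, encComparison, tuple]

theorem untuple_opsWord : untuple opsWord = ops.map encOp := untuple_tuple _

theorem tuple_append (l l' : List Word) : tuple (l ++ l') = tuple l ++ tuple l' :=
  List.flatMap_append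

section Encoding

variable (code) (q : Query D)

theorem hd_encQuery : hd (encQuery code q) = tuple q.summary := hd_tuple_cons _ _

theorem atomsWord_encQuery :
    atomsWord (encQuery code q) = tuple (q.atoms.map (encAtom code)) := by
  simp [atomsWord, encQuery]

theorem compsWord_encQuery :
    compsWord (encQuery code q) = tuple (q.comps.map (encComparison code)) := by
  simp [compsWord, encQuery]

theorem adomWord_encQuery :
    adomWord (encQuery code q) = tuple (q.adomList.map (encTerm code)) := by
  rw [adomWord, hd_encQuery, atomsWord_encQuery, compsWord_encQuery, untuple_tuple,
    untuple_tuple, untuple_tuple, Query.adomList, List.map_append, List.map_append, tuple_append,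
    tuple_append, List.append_assoc]
  congr 1
  · simp [tuple, List.flatMap_map, encTerm]
  congr 1
  · simp [tuple, List.flatMap_map, List.map_flatMap, List.flatMap_assoc, encAtom]
  · simp [tuple, List.flatMap_map, List.map_flatMap, List.flatMap_assoc, encComparison]

theorem untuple_adomWord :
    untuple (adomWord (encQuery code q)) = q.adomList.map (encTerm code) := by
  rw [adomWord_encQuery, untuple_tuple]

end Encoding

theorem forall_mem_adomWord {q : Query D} {p : Word → Prop} :
    (∀ t ∈ untuple (adomWord (encQuery code q)), p t) ↔ ∀ t ∈ q.adom, p (encTerm code t) := by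
  rw [untuple_adomWord]
  simp [Query.mem_adomList]

/-- The finite function with the arguments in `K` and the values of `φ` there. -/
def encFun (K : List Word) (φ : Word → Word) : Word :=
  tuple (K.dedup.map (fun k => block k ++ φ k))

theorem app_encFun {K : List Word} {φ : Word → Word} {k : Word} (hk : k ∈ K) :
    app (encFun K φ) k = φ k := by
  have main : ∀ l : List Word, l.Nodup → k ∈ l →
      (l.flatMap fun e => if e = k then φ e else []) = φ k := by
    intro l
    induction l with
    | nil => simp
    | cons e l ih =>
      intro hnd hkl
      rw [List.nodup_cons] at hnd
      rw [List.flatMap_cons]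
      by_cases he : e = k
      · subst he
        have : (l.flatMap fun e' => if e' = e then φ e' else []) = [] := by
          rw [List.flatMap_eq_nil_iff]
          intro x hx
          rw [if_neg]
          rintro rfl
          exact hnd.1 hx
        rw [this]
        simp
      · rw [if_neg he, ih hnd.2 (by simpa [Ne.symm he] using hkl)]
        rfl
  have := main K.dedup (List.nodup_dedup K) (List.mem_dedup.2 hk)
  simpa [app, encFun, List.flatMap_map] using this

theorem length_tuple_le {l : List Word} {m : ℕ} (h : ∀ w ∈ l, w.length ≤ m) :
    (tuple l).length ≤ l.length * (2 * m + 1) := by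
  induction l with
  | nil => simp [tuple]
  | cons w l ih =>
    have h1 := h w (by simp)
    have h2 := ih fun w' hw' => h w' (by simp [hw'])
    rw [tuple_cons, List.length_append, length_block, List.length_cons, Nat.add_mul]
    omega

theorem length_le_length_tuple (l : List Word) : l.length ≤ (tuple l).length := by
  induction l with
  | nil => simp
  | cons w l ih =>
    rw [tuple_cons, List.length_append, length_block, List.length_cons]
    omega

theorem length_le_of_mem {l : List Word} {w : Word} (h : w ∈ l) :
    w.length ≤ (tuple l).length := by
  induction l with
  | nil => simp at h
  | cons w' l ih =>
    rw [tuple_cons, List.length_append, length_block]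
    rcases List.mem_cons.1 h with rfl | h
    · omega
    · have := ih h
      omega

/-- A bound for the length of a finite function on a set of words of total length at most `n`, with
values of length at most `n`. -/
theorem length_encFun_le {K : List Word} {φ : Word → Word} {n : ℕ} (hK : (tuple K).length ≤ n)
    (hφ : ∀ k ∈ K, (φ k).length ≤ n) : (encFun K φ).length ≤ n * (6 * n + 3) := by
  refine (length_tuple_le (m := 3 * n + 1) ?_).trans ?_
  · intro w hw
    obtain ⟨k, hk, rfl⟩ := List.mem_map.1 hw
    rw [List.mem_dedup] at hk
    have := hφ k hk
    have := length_le_of_mem hk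
    rw [List.length_append, length_block]
    omega
  · rw [List.length_map]
    refine Nat.mul_le_mul ?_ (by omega)
    exact ((List.dedup_sublist K).length_le.trans (length_le_length_tuple K)).trans hK

/-! ### Rankings and linearizations -/

/-- The total preorder of the terms that a ranking describes. -/
def rankRel (code : D → Word) (L : Word) (r s : Term D) : Prop :=
  RankLE L (encTerm code r) (encTerm code s)

theorem rankHolds_iff {L : Word} {op : Op} {r s : Term D} :
    RankHolds L (encOp op) (encTerm code r) (encTerm code s) ↔
      Holds (rankRel code L) r op s := by
  cases op <;> simp [RankHolds, encOp, Holds, rankRel]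

theorem holds_congr {L L' : Term D → Term D → Prop} {r s : Term D} (h : L r s ↔ L' r s)
    (h' : L s r ↔ L' s r) (op : Op) : Holds L r op s ↔ Holds L' r op s := by
  cases op <;> simp [Holds, h, h']

theorem mem_comps_encQuery {q : Query D} {p : Word → Word → Word → Prop} :
    (∀ c ∈ untuple (compsWord (encQuery code q)), p (hd c) (hd (tl c)) (hd (tl (tl c)))) ↔
      ∀ c ∈ q.comps, p (encOp c.op) (encTerm code c.lhs) (encTerm code c.rhs) := by
  rw [compsWord_encQuery, untuple_tuple]
  simp [encComparison]

section Order

variable [LinearOrder D] {q q₁ q₂ : Query D} {R : Set Word}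

theorem rankLinearizes_iff (hR : ∀ a b : D, tuple [code a, code b] ∈ R ↔ a ≤ b) {L : Word} :
    RankLinearizes R (encQuery code q) L ↔ IsLinearization q (rankRel code L) := by
  rw [RankLinearizes, mem_comps_encQuery]
  simp only [forall_mem_adomWord, rankHolds_iff]
  have hR' : ∀ a b : D, block (code a) ++ block (code b) ∈ R ↔ a ≤ b := fun a b => by
    rw [← hR]; simp [tuple]
  constructor
  · rintro ⟨h1, h2⟩
    refine ⟨fun r _ s _ => le_total _ _, fun r _ s _ t _ => le_trans, fun c d hc hd => ?_, h1⟩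
    have := h2 _ hc _ hd (isConst_encTerm.2 ⟨c, rfl⟩) (isConst_encTerm.2 ⟨d, rfl⟩)
    rw [← hR' c d]
    exact this
  · intro h
    refine ⟨h.comps, fun r hr s hs hcr hcs => ?_⟩
    obtain ⟨c, rfl⟩ := isConst_encTerm.1 hcr
    obtain ⟨d, rfl⟩ := isConst_encTerm.1 hcs
    rw [show RankLE L (encTerm code (Term.const c)) (encTerm code (Term.const d)) ↔ _ from
      h.const c d hr hs, ← hR' c d]
    rfl

theorem IsLinearization.congr {L L' : Term D → Term D → Prop} (h : IsLinearization q L)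
    (hL : ∀ r ∈ q.adom, ∀ s ∈ q.adom, L' r s ↔ L r s) : IsLinearization q L' where
  total r hr s hs := by
    rw [hL r hr s hs, hL s hs r hr]
    exact h.total r hr s hs
  trans r hr s hs t ht := by
    rw [hL r hr s hs, hL s hs t ht, hL r hr t ht]
    exact h.trans r hr s hs t ht
  const c d hc hd := by
    rw [hL _ hc _ hd]
    exact h.const c d hc hd
  comps c hc := by
    have hl := Query.lhs_mem_adom hc
    have hr := Query.rhs_mem_adom hc
    exact (holds_congr (hL _ hl _ hr) (hL _ hr _ hl) _).2 (h.comps c hc)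

/-- The bound for the lengths of finite functions on the terms of the query encoded by `w`. -/
def funBound (w : Word) : ℕ := (adomWord w).length * (6 * (adomWord w).length + 3)

/-- Every linearization is given by a short ranking: the value of a term counts the occurrences of
smaller terms. -/
theorem exists_ranking (hcode : Function.Injective code) {M : Term D → Term D → Prop}
    (hM : IsLinearization q M) : ∃ L : Word, L.length ≤ funBound (encQuery code q) ∧
      ∀ r ∈ q.adom, ∀ s ∈ q.adom, rankRel code L r s ↔ M r s := by
  classical
  let below : Term D → Finset ℕ := fun r => {i ∈ Finset.range q.adomList.length |
    ∃ t, q.adomList[i]? = some t ∧ ¬ M r t}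
  let φ : Word → Word := fun k =>
    if h : ∃ r, encTerm code r = k then List.replicate (below h.choose).card true else []
  have hφ : ∀ r, φ (encTerm code r) = List.replicate (below r).card true := by
    intro r
    have h : ∃ r', encTerm code r' = encTerm code r := ⟨r, rfl⟩
    simp only [φ, dif_pos h]
    rw [encTerm_injective hcode h.choose_spec]
  have hcard : ∀ r, (below r).card ≤ q.adomList.length := fun r =>
    (Finset.card_filter_le _ _).trans (by simp)
  refine ⟨encFun (q.adomList.map (encTerm code)) φ, ?_, fun r hr s hs => ?_⟩
  · rw [funBound, adomWord_encQuery]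
    refine length_encFun_le le_rfl fun k hk => ?_
    obtain ⟨r, hr, rfl⟩ := List.mem_map.1 hk
    rw [hφ, List.length_replicate]
    refine (hcard r).trans ?_
    simpa using length_le_length_tuple (q.adomList.map (encTerm code))
  · have hr' : encTerm code r ∈ q.adomList.map (encTerm code) :=
      List.mem_map_of_mem (Query.mem_adomList.2 hr)
    have hs' : encTerm code s ∈ q.adomList.map (encTerm code) :=
      List.mem_map_of_mem (Query.mem_adomList.2 hs)
    rw [rankRel, RankLE, app_encFun hr', app_encFun hs', hφ, hφ, List.length_replicate,
      List.length_replicate]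
    have sub : ∀ r ∈ q.adom, ∀ s ∈ q.adom, M r s → below r ⊆ below s := by
      intro r hr s hs hrs i hi
      simp only [below, Finset.mem_filter] at hi ⊢
      obtain ⟨hi, t, ht, hrt⟩ := hi
      exact ⟨hi, t, ht, fun hst => hrt (hM.trans r hr s hs t
        (Query.mem_adomList.1 (List.mem_of_getElem? ht)) hrs hst)⟩
    constructor
    · intro hle
      by_contra hrs
      have hsr : M s r := (hM.total r hr s hs).resolve_left hrs
      -- The occurrences of `s` count for `r`, but not for `s`.
      obtain ⟨i, hi⟩ := List.mem_iff_getElem?.1 (Query.mem_adomList.2 hs)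
      have hss : M s s := (hM.total s hs s hs).elim id id
      have : below s ⊂ below r := by
        refine Finset.ssubset_iff_subset_ne.2 ⟨sub s hs r hr hsr, fun he => ?_⟩
        have hir : i ∈ below r := by
          simp only [below, Finset.mem_filter, Finset.mem_range]
          exact ⟨(List.getElem?_eq_some_iff.1 hi).1, s, hi, hrs⟩
        rw [← he] at hir
        simp only [below, Finset.mem_filter] at hir
        obtain ⟨-, t, ht, hst⟩ := hir
        rw [hi, Option.some.injEq] at ht
        exact hst (ht ▸ hss)
      exact absurd (Finset.card_lt_card this) (not_lt.2 hle)
    · exact fun hrs => Finset.card_le_card (sub r hr s hs hrs)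

end Order

/-! ### Homomorphisms as words -/

/-- On the terms of `q`, the finite function `h` is the map `f`. -/
def Represents (code : D → Word) (q : Query D) (h : Word) (f : Term D → Term D) : Prop :=
  ∀ t ∈ q.adom, app h (encTerm code t) = encTerm code (f t)

theorem Represents.mapAtom {q : Query D} {h : Word} {f : Term D → Term D}
    (hf : Represents code q h f) {a : Atom D} (ha : ∀ t ∈ a.args, t ∈ q.adom) :
    mapAtom h (encAtom code a) = encAtom code ⟨a.rel, a.args.map f⟩ := by
  rw [encAtom, encAtom, CQC.mapAtom, hd_tuple_cons, tl_tuple_cons, untuple_tuple, tuple_cons,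
    List.flatMap_map]
  congr 1
  rw [List.map_map, tuple, List.flatMap_map]
  exact List.flatMap_congr fun t ht => by rw [hf t (ha t ht)]; rfl

theorem MapsAtoms.exists_represents {q₁ q₂ : Query D} {h : Word}
    (hh : MapsAtoms (encQuery code q₁) (encQuery code q₂) h) :
    ∃ f, Represents code q₁ h f := by
  have h2 := forall_mem_adomWord.1 hh.2.1
  rw [untuple_adomWord] at h2
  have : ∀ t, ∃ t', t ∈ q₁.adom → app h (encTerm code t) = encTerm code t' := by
    intro t
    by_cases ht : t ∈ q₁.adom
    · obtain ⟨t', -, ht'⟩ := List.mem_map.1 (h2 t ht)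
      exact ⟨t', fun _ => ht'.symm⟩
    · exact ⟨t, fun h => absurd h ht⟩
  choose f hf using this
  exact ⟨f, hf⟩

theorem mapsAtoms_iff (hcode : Function.Injective code) {q₁ q₂ : Query D} {h : Word}
    {f : Term D → Term D} (hf : Represents code q₁ h f) :
    MapsAtoms (encQuery code q₁) (encQuery code q₂) h ↔ q₁.summary = q₂.summary ∧
      Set.MapsTo f q₁.adom q₂.adom ∧ (∀ x ∈ q₁.summary, f (Term.var x) = Term.var x) ∧
      (∀ c : D, Term.const c ∈ q₁.adom → f (Term.const c) = Term.const c) ∧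
      ∀ a ∈ q₁.atoms, (⟨a.rel, a.args.map f⟩ : Atom D) ∈ q₂.atoms := by
  have hinj := encTerm_injective hcode
  refine and_congr ?_ (and_congr ?_ (and_congr ?_ (and_congr ?_ ?_)))
  · rw [hd_encQuery, hd_encQuery]
    exact tuple_injective.eq_iff
  · rw [forall_mem_adomWord, untuple_adomWord]
    refine forall₂_congr fun t ht => ?_
    rw [hf t ht, List.mem_map_of_injective hinj, Query.mem_adomList]
  · rw [hd_encQuery, untuple_tuple]
    refine forall₂_congr fun x hx => ?_
    rw [show true :: x = encTerm code (Term.var x) from rfl, hf _ (Query.var_mem_adom hx),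
      hinj.eq_iff]
  · rw [forall_mem_adomWord]
    constructor
    · intro H c hc
      have := H _ hc (isConst_encTerm.2 ⟨c, rfl⟩)
      rwa [hf _ hc, hinj.eq_iff] at this
    · intro H t ht htc
      obtain ⟨c, rfl⟩ := isConst_encTerm.1 htc
      rw [hf _ ht, H c ht]
  · rw [atomsWord_encQuery, atomsWord_encQuery, untuple_tuple, untuple_tuple, List.forall_mem_map]
    refine forall₂_congr fun a ha => ?_
    rw [hf.mapAtom fun t ht => Query.arg_mem_adom ha ht,
      List.mem_map_of_injective (encAtom_injective hcode)]

/-- Every map between the terms of two queries is a short finite function. -/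
theorem exists_represents (hcode : Function.Injective code) {q₁ q₂ : Query D}
    {f : Term D → Term D} (hf : Set.MapsTo f q₁.adom q₂.adom) {n : ℕ}
    (h₁ : (adomWord (encQuery code q₁)).length ≤ n)
    (h₂ : (adomWord (encQuery code q₂)).length ≤ n) :
    ∃ h : Word, h.length ≤ n * (6 * n + 3) ∧ Represents code q₁ h f := by
  classical
  let φ : Word → Word := fun k =>
    if h : ∃ r, encTerm code r = k then encTerm code (f h.choose) else []
  have hφ : ∀ r, φ (encTerm code r) = encTerm code (f r) := by
    intro r
    have h : ∃ r', encTerm code r' = encTerm code r := ⟨r, rfl⟩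
    simp only [φ, dif_pos h]
    rw [encTerm_injective hcode h.choose_spec]
  rw [adomWord_encQuery] at h₁ h₂
  refine ⟨encFun (q₁.adomList.map (encTerm code)) φ, length_encFun_le h₁ fun k hk => ?_,
    fun t ht => ?_⟩
  · obtain ⟨r, hr, rfl⟩ := List.mem_map.1 hk
    rw [hφ]
    exact (length_le_of_mem (List.mem_map_of_mem (f := encTerm code)
      (Query.mem_adomList.2 (hf (Query.mem_adomList.1 hr))))).trans h₂
  · rw [app_encFun (List.mem_map_of_mem (Query.mem_adomList.2 ht)), hφ]

theorem tuple_map_flatMap {α β : Type*} (e : β → Word) (F : α → List β) (l : List α) :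
    tuple ((l.flatMap F).map e) = l.flatMap (fun a => tuple ((F a).map e)) := by
  simp [tuple, List.map_flatMap, List.flatMap_assoc]

theorem tuple_map_filter {α : Type*} (e : α → Word) (p : α → Bool) (l : List α) :
    tuple ((l.filter p).map e) = l.flatMap (fun a => if p a then block (e a) else []) := by
  induction l with
  | nil => rfl
  | cons a l ih =>
    rw [List.flatMap_cons, ← ih, List.filter_cons]
    split_ifs <;> simp [tuple_cons]

theorem imageWord_encQuery {q : Query D} {h : Word} {f : Term D → Term D}
    (hf : Represents code q h f) :
    untuple (imageWord (encQuery code q) h) = (q.adomList.map f).map (encTerm code) := by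
  have : imageWord (encQuery code q) h = tuple ((q.adomList.map f).map (encTerm code)) := by
    rw [imageWord, untuple_adomWord, tuple, List.map_map, List.flatMap_map, List.flatMap_map]
    exact List.flatMap_congr fun t ht => by rw [hf t (Query.mem_adomList.1 ht)]; rfl
  rw [this, untuple_tuple]

section Order

variable [LinearOrder D] {q : Query D} {R : Set Word} {h F : Word} {f : Term D → Term D}

/-- What holds in all rankings of `F` is what `q` entails. -/
def DescribesEntailment (code : D → Word) (q : Query D) (F : Word) : Prop :=
  ∀ r ∈ q.adom, ∀ s ∈ q.adom, ∀ op,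
    (AllHold F (encOp op) (encTerm code r) (encTerm code s) ↔ Entails q r op s)

theorem mapsComps_iff (hcode : Function.Injective code) (hf : Represents code q h f)
    (hF : DescribesEntailment code q F) : MapsComps (encQuery code q) h F ↔ IsHom q q f := by
  rw [MapsComps, mapsAtoms_iff hcode hf, mem_comps_encQuery
    (p := fun op r s => AllHold F op (app h r) (app h s))]
  have key : Set.MapsTo f q.adom q.adom → ∀ c ∈ q.comps,
      (AllHold F (encOp c.op) (app h (encTerm code c.lhs)) (app h (encTerm code c.rhs)) ↔
        Entails q (f c.lhs) c.op (f c.rhs)) := fun hm c hc => by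
    have hl := Query.lhs_mem_adom hc
    have hr := Query.rhs_mem_adom hc
    rw [hf _ hl, hf _ hr, hF _ (hm hl) _ (hm hr)]
  constructor
  · rintro ⟨⟨h1, h2, h3, h4, h5⟩, h6⟩
    exact ⟨h1, h2, h3, h4, h5, fun c hc => (key h2 c hc).1 (h6 c hc)⟩
  · rintro ⟨h1, h2, h3, h4, h5, h6⟩
    exact ⟨⟨h1, h2, h3, h4, h5⟩, fun c hc => (key h2 c hc).2 (h6 c hc)⟩

theorem inducedWord_encQuery (hcode : Function.Injective code) (hf : Represents code q h f)
    (hm : Set.MapsTo f q.adom q.adom) (hF : DescribesEntailment code q F) :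
    inducedWord (encQuery code q) h F =
      encQuery code (q.induced (q.adomList.map f)) := by
  classical
  have hS : ∀ t ∈ q.adomList.map f, t ∈ q.adom := by
    intro t ht
    obtain ⟨r, hr, rfl⟩ := List.mem_map.1 ht
    exact hm (Query.mem_adomList.1 hr)
  rw [inducedWord, imageWord_encQuery hf, hd_encQuery, atomsWord_encQuery, untuple_tuple,
    untuple_opsWord, encQuery, tuple_cons, tuple_cons, tuple_cons, tuple_nil, List.append_nil,
    Query.induced]
  set S := q.adomList.map f
  congr 3
  · rw [tuple_map_filter, List.flatMap_map]
    refine List.flatMap_congr fun a _ => ?_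
    have : (∀ t ∈ untuple (tl (encAtom code a)), t ∈ S.map (encTerm code)) ↔
        ∀ t ∈ a.args, t ∈ S := by
      rw [encAtom, tl_tuple_cons, untuple_tuple, List.forall_mem_map]
      simp only [List.mem_map_of_injective (encTerm_injective hcode)]
    simp only [this, decide_eq_true_eq]
  · rw [tuple_map_flatMap, List.flatMap_map]
    refine List.flatMap_congr fun r hr => ?_
    rw [tuple_map_flatMap, List.flatMap_map]
    refine List.flatMap_congr fun s hs => ?_
    rw [tuple_map_flatMap, List.flatMap_map]
    refine List.flatMap_congr fun op _ => ?_
    by_cases he : Entails q r op s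
    · rw [if_pos ((hF r (hS r hr) s (hS s hs) op).2 he), if_pos he, compWord_eq]
      simp [tuple]
    · rw [if_neg (fun h => he ((hF r (hS r hr) s (hS s hs) op).1 h)), if_neg he]
      rfl

/-- The cores of `q` that are induced on the image of an endomorphism. -/
def Query.inducedCores (q : Query D) : Set (Query D) :=
  {C | ∃ f, IsHom q q f ∧ (∀ g, IsHom q q g →
      ∀ r ∈ q.adom, ∀ s ∈ q.adom, g (f r) = g (f s) → f r = f s) ∧
    C = q.induced (q.adomList.map f)}

theorem isCore_of_mem_inducedCores {C : Query D} (hC : C ∈ q.inducedCores) : IsCore q C := by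
  obtain ⟨f, hf, hinj, rfl⟩ := hC
  exact isCore_induced hf hinj

theorem inducedCores_nonempty (q : Query D) : q.inducedCores.Nonempty :=
  let ⟨f, hf, hinj⟩ := exists_isHom_injOn_image q
  ⟨_, f, hf, hinj, rfl⟩

/-- If `h` and `F` pass the test against all short words, then they describe a core. -/
theorem exists_core_of_coreTest (hcode : Function.Injective code)
    (hR : ∀ a b : D, tuple [code a, code b] ∈ R ↔ a ≤ b)
    (H : ∀ g L : Word, g.length ≤ funBound (encQuery code q) →
      L.length ≤ funBound (encQuery code q) → CoreTest R (encQuery code q) h F g L) :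
    ∃ C ∈ q.inducedCores, inducedWord (encQuery code q) h F = encQuery code C := by
  have H0 := H [] [] (by simp) (by simp)
  obtain ⟨f, hf⟩ := H0.1.1.exists_represents
  have hF : DescribesEntailment code q F := by
    intro r hr s hs op
    constructor
    · intro hall M hM
      obtain ⟨L, hL, hLM⟩ := exists_ranking hcode hM
      have h1 := (H [] L (by simp) hL).2.2.1 ((rankLinearizes_iff hR).2 (hM.congr hLM))
        (encTerm code r) (by simpa [untuple_adomWord] using ⟨r, Query.mem_adomList.2 hr, rfl⟩)
        (encTerm code s) (by simpa [untuple_adomWord] using ⟨s, Query.mem_adomList.2 hs, rfl⟩)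
        (encOp op) (by simpa [untuple_opsWord] using ⟨op, mem_ops op, rfl⟩) hall
      rw [rankHolds_iff] at h1
      exact (holds_congr (hLM r hr s hs) (hLM s hs r hr) op).1 h1
    · intro he L hL
      exact rankHolds_iff.2 (he _ ((rankLinearizes_iff hR).1 (H0.2.1 L hL)))
  have hhom := (mapsComps_iff hcode hf hF).1 H0.1
  refine ⟨_, ⟨f, hhom, fun g hg r hr s hs hrs => ?_, rfl⟩,
    inducedWord_encQuery hcode hf hhom.mapsTo hF⟩
  obtain ⟨g', hg', hgg⟩ := exists_represents hcode hg.mapsTo le_rfl le_rfl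
  have h1 := forall_mem_adomWord.1 (forall_mem_adomWord.1
    ((H g' [] hg' (by simp)).2.2.2 ((mapsComps_iff hcode hgg hF).2 hg)) r hr) s hs
  rw [hf r hr, hf s hs, hgg _ (hhom.mapsTo hr), hgg _ (hhom.mapsTo hs), hrs] at h1
  exact encTerm_injective hcode (h1 rfl)

/-- The bound for the length of the sequence of rankings in a certificate. -/
def familyBound (w : Word) : ℕ :=
  3 * (adomWord w).length * (adomWord w).length * (2 * funBound w + 1)

/-- There is a short sequence of linearizations that describes entailment: it contains, for every
comparison that is not entailed, a linearization that violates it. -/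
theorem exists_describesEntailment (hcode : Function.Injective code)
    (hR : ∀ a b : D, tuple [code a, code b] ∈ R ↔ a ≤ b) (q : Query D) :
    ∃ F : Word, F.length ≤ familyBound (encQuery code q) ∧ DescribesEntailment code q F ∧
      ∀ L ∈ untuple F, RankLinearizes R (encQuery code q) L := by
  classical
  let P : Comparison D → Word → Prop := fun c L => L.length ≤ funBound (encQuery code q) ∧
    IsLinearization q (rankRel code L) ∧ ¬ Holds (rankRel code L) c.lhs c.op c.rhs
  let T : List (Comparison D) := q.adomList.flatMap fun r => q.adomList.flatMap fun s =>
    ops.map fun op => ⟨r, op, s⟩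
  have hT : ∀ r ∈ q.adom, ∀ s ∈ q.adom, ∀ op, (⟨r, op, s⟩ : Comparison D) ∈ T := by
    intro r hr s hs op
    simp only [T, List.mem_flatMap, List.mem_map]
    exact ⟨r, Query.mem_adomList.2 hr, s, Query.mem_adomList.2 hs, op, mem_ops op, rfl⟩
  let l : List Word := (T.filter fun c => ∃ L, P c L).map fun c =>
    if h : ∃ L, P c L then h.choose else []
  have hl : ∀ L ∈ l, ∃ c, P c L := by
    intro L hL
    obtain ⟨c, hc, rfl⟩ := List.mem_map.1 hL
    have hc' : ∃ L, P c L := by simpa using (List.mem_filter.1 hc).2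
    rw [dif_pos hc']
    exact ⟨c, hc'.choose_spec⟩
  have hl' : ∀ c ∈ T, (∃ L, P c L) → ∃ L ∈ l, P c L := by
    intro c hc hex
    refine ⟨hex.choose, List.mem_map.2 ⟨c, List.mem_filter.2 ⟨hc, by simpa using hex⟩, ?_⟩,
      hex.choose_spec⟩
    rw [dif_pos hex]
  refine ⟨tuple l, ?_, fun r hr s hs op => ⟨fun hall M hM => ?_, fun he L hL => ?_⟩, ?_⟩
  · refine (length_tuple_le fun L hL => (hl L hL).choose_spec.1).trans ?_
    refine Nat.mul_le_mul ?_ le_rfl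
    have hlen : q.adomList.length ≤ (adomWord (encQuery code q)).length := by
      rw [adomWord_encQuery]
      simpa using length_le_length_tuple (q.adomList.map (encTerm code))
    have hTlen : T.length = 3 * q.adomList.length * q.adomList.length := by
      simp [T, ops]; ring
    calc l.length ≤ T.length := by
          rw [List.length_map]; exact List.length_filter_le _ _
      _ ≤ _ := by rw [hTlen]; gcongr
  · by_contra hn
    obtain ⟨L, hL, hLM⟩ := exists_ranking hcode hM
    obtain ⟨L', hL', hP⟩ := hl' ⟨r, op, s⟩ (hT r hr s hs op) ⟨L, hL, hM.congr hLM, fun h =>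
      hn ((holds_congr (hLM r hr s hs) (hLM s hs r hr) op).1 h)⟩
    exact hP.2.2 (rankHolds_iff.1 (hall L' (by rwa [untuple_tuple])))
  · rw [untuple_tuple] at hL
    obtain ⟨c, hc⟩ := hl L hL
    exact rankHolds_iff.2 (he _ hc.2.1)
  · intro L hL
    rw [untuple_tuple] at hL
    obtain ⟨c, hc⟩ := hl L hL
    exact (rankLinearizes_iff hR).2 hc.2.1

/-- Every induced core is described by short words that pass the test against all words. -/
theorem exists_coreTest (hcode : Function.Injective code)
    (hR : ∀ a b : D, tuple [code a, code b] ∈ R ↔ a ≤ b) {C : Query D}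
    (hC : C ∈ q.inducedCores) :
    ∃ h F : Word, h.length ≤ funBound (encQuery code q) ∧
      F.length ≤ familyBound (encQuery code q) ∧
      (∀ g L, CoreTest R (encQuery code q) h F g L) ∧
      inducedWord (encQuery code q) h F = encQuery code C := by
  obtain ⟨f, hf, hinj, rfl⟩ := hC
  obtain ⟨F, hFlen, hF, hFlin⟩ := exists_describesEntailment hcode hR q
  obtain ⟨h, hhlen, hh⟩ := exists_represents hcode hf.mapsTo le_rfl le_rfl
  refine ⟨h, F, hhlen, hFlen, fun g L => ⟨(mapsComps_iff hcode hh hF).2 hf, hFlin, ?_, ?_⟩,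
    inducedWord_encQuery hcode hh hf.mapsTo hF⟩
  · intro hL
    rw [forall_mem_adomWord]
    intro r hr
    rw [forall_mem_adomWord]
    intro s hs op hop hall
    rw [untuple_opsWord] at hop
    obtain ⟨op, -, rfl⟩ := List.mem_map.1 hop
    exact rankHolds_iff.2 ((hF r hr s hs op).1 hall _ ((rankLinearizes_iff hR).1 hL))
  · intro hg
    obtain ⟨g', hg'⟩ := hg.1.exists_represents
    rw [forall_mem_adomWord]
    intro r hr
    rw [forall_mem_adomWord]
    intro s hs hrs
    rw [hh r hr, hh s hs, hg' _ (hf.mapsTo hr), hg' _ (hf.mapsTo hs)] at hrs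
    rw [hh r hr, hh s hs, hinj g' ((mapsComps_iff hcode hg' hF).1 hg) r hr s hs
      (encTerm_injective hcode hrs)]

end Order

/-! ### Isomorphisms as words -/

theorem isoTest_iff (hcode : Function.Injective code) {C₁ C₂ : Query D} {h : Word}
    {f : Term D → Term D} (hf : Represents code C₁ h f) :
    IsoTest (encQuery code C₁) (encQuery code C₂) h ↔ C₁.summary = C₂.summary ∧
      Set.BijOn f C₁.adom C₂.adom ∧ (∀ x ∈ C₁.summary, f (Term.var x) = Term.var x) ∧
      (∀ c : D, Term.const c ∈ C₁.adom → f (Term.const c) = Term.const c) ∧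
      (∀ R : Word, ∀ z : List (Term D), (∀ t ∈ z, t ∈ C₁.adom) →
        ((⟨R, z⟩ : Atom D) ∈ C₁.atoms ↔ (⟨R, z.map f⟩ : Atom D) ∈ C₂.atoms)) ∧
      (∀ r ∈ C₁.adom, ∀ s ∈ C₁.adom, ∀ op : Op,
        ((⟨r, op, s⟩ : Comparison D) ∈ C₁.comps ↔
          (⟨f r, op, f s⟩ : Comparison D) ∈ C₂.comps)) := by
  have hinj := encTerm_injective hcode
  have e2 : (∀ t ∈ untuple (adomWord (encQuery code C₂)),
      ∃ r ∈ untuple (adomWord (encQuery code C₁)), app h r = t) ↔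
        Set.SurjOn f C₁.adom C₂.adom := by
    rw [forall_mem_adomWord, untuple_adomWord]
    refine forall₂_congr fun t ht => ?_
    simp only [List.mem_map, exists_exists_and_eq_and, Query.mem_adomList, Set.mem_image]
    refine exists_congr fun r => and_congr_right fun hr => ?_
    rw [hf r hr, hinj.eq_iff]
  have e3 : (∀ r ∈ untuple (adomWord (encQuery code C₁)),
      ∀ s ∈ untuple (adomWord (encQuery code C₁)), app h r = app h s → r = s) ↔
        Set.InjOn f C₁.adom := by
    simp only [forall_mem_adomWord]
    refine forall₂_congr fun r hr => forall₂_congr fun s hs => ?_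
    rw [hf r hr, hf s hs, hinj.eq_iff, hinj.eq_iff]
  have e4 : (∀ b ∈ untuple (atomsWord (encQuery code C₂)),
      ∃ a ∈ untuple (atomsWord (encQuery code C₁)), mapAtom h a = b) ↔
        ∀ b ∈ C₂.atoms, ∃ a ∈ C₁.atoms, (⟨a.rel, a.args.map f⟩ : Atom D) = b := by
    rw [atomsWord_encQuery, atomsWord_encQuery, untuple_tuple, untuple_tuple, List.forall_mem_map]
    refine forall₂_congr fun b hb => ?_
    simp only [List.mem_map, exists_exists_and_eq_and]
    refine exists_congr fun a => and_congr_right fun ha => ?_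
    rw [hf.mapAtom fun t ht => Query.arg_mem_adom ha ht, (encAtom_injective hcode).eq_iff]
  have e5 : (∀ r ∈ untuple (adomWord (encQuery code C₁)),
      ∀ s ∈ untuple (adomWord (encQuery code C₁)), ∀ op ∈ untuple opsWord,
        (compWord op r s ∈ untuple (compsWord (encQuery code C₁)) ↔
          compWord op (app h r) (app h s) ∈ untuple (compsWord (encQuery code C₂)))) ↔
      ∀ r ∈ C₁.adom, ∀ s ∈ C₁.adom, ∀ op : Op,
        ((⟨r, op, s⟩ : Comparison D) ∈ C₁.comps ↔
          (⟨f r, op, f s⟩ : Comparison D) ∈ C₂.comps) := by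
    simp only [forall_mem_adomWord]
    refine forall₂_congr fun r hr => forall₂_congr fun s hs => ?_
    rw [untuple_opsWord, List.forall_mem_map, compsWord_encQuery, compsWord_encQuery,
      untuple_tuple, untuple_tuple]
    simp only [mem_ops, forall_true_left]
    refine forall_congr' fun op => ?_
    rw [hf r hr, hf s hs, compWord_eq, compWord_eq,
      List.mem_map_of_injective (encComparison_injective hcode),
      List.mem_map_of_injective (encComparison_injective hcode)]
  rw [IsoTest, mapsAtoms_iff hcode hf, e2, e3, e4, e5]
  constructor
  · rintro ⟨⟨h1, h2, h3, h4, h5⟩, hs, hi, ha, hc⟩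
    refine ⟨h1, ⟨h2, hi, hs⟩, h3, h4, fun R z hz => ⟨fun h => h5 _ h, fun h => ?_⟩, hc⟩
    obtain ⟨⟨R', z'⟩, hx, he⟩ := ha _ h
    simp only [Atom.mk.injEq] at he
    rwa [← he.1, ← map_eq_map_of_injOn hi (fun t ht => Query.arg_mem_adom hx ht) hz he.2]
  · rintro ⟨h1, ⟨h2, hi, hs⟩, h3, h4, h5, hc⟩
    refine ⟨⟨h1, h2, h3, h4, fun a ha => (h5 a.rel a.args
      fun t ht => Query.arg_mem_adom ha ht).1 ha⟩, hs, hi, fun b hb => ?_, hc⟩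
    -- The arguments of `b` have preimages, as `f` is surjective.
    choose! k hk using hs
    have hz : (b.args.map k).map f = b.args := by
      rw [List.map_map, List.map_congr_left (g := id), List.map_id]
      exact fun t ht => (hk (Query.arg_mem_adom hb ht)).2
    refine ⟨⟨b.rel, b.args.map k⟩, (h5 _ _ fun t ht => ?_).2 (by rwa [hz]), by rw [hz]⟩
    obtain ⟨s, hs, rfl⟩ := List.mem_map.1 ht
    exact (hk (Query.arg_mem_adom hb hs)).1

theorem isomorphic_of_isoTest (hcode : Function.Injective code) {C₁ C₂ : Query D} {h : Word}
    (hh : IsoTest (encQuery code C₁) (encQuery code C₂) h) : Isomorphic C₁ C₂ := by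
  obtain ⟨f, hf⟩ := hh.1.exists_represents
  obtain ⟨h1, h2⟩ := (isoTest_iff hcode hf).1 hh
  exact ⟨h1, f, h2⟩

theorem exists_isoTest (hcode : Function.Injective code) {C₁ C₂ : Query D}
    (hC : Isomorphic C₁ C₂) {n : ℕ} (h₁ : (adomWord (encQuery code C₁)).length ≤ n)
    (h₂ : (adomWord (encQuery code C₂)).length ≤ n) :
    ∃ h : Word, h.length ≤ n * (6 * n + 3) ∧
      IsoTest (encQuery code C₁) (encQuery code C₂) h := by
  obtain ⟨h1, f, h2⟩ := hC
  obtain ⟨h, hlen, hf⟩ := exists_represents hcode h2.1.mapsTo h₁ h₂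
  exact ⟨h, hlen, (isoTest_iff hcode hf).2 ⟨h1, h2⟩⟩

/-! ### The oracles -/

theorem exists_bounds : ∃ pA pF pM : Polynomial ℕ, ∀ w : Word,
    (adomWord w).length ≤ pA.eval w.length ∧ funBound w ≤ pF.eval w.length ∧
      familyBound w ≤ pM.eval w.length := by
  obtain ⟨pA, hA⟩ := (polyFun_adomWord (PolyFun.id (O := ∅))).length_le
  refine ⟨pA, pA * (6 * pA + 3), 3 * pA * pA * (2 * (pA * (6 * pA + 3)) + 1), fun w => ?_⟩
  have h := hA w
  have hF : funBound w ≤ (pA * (6 * pA + 3)).eval w.length := by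
    simp only [funBound, Polynomial.eval_mul, Polynomial.eval_add, Polynomial.eval_ofNat]
    gcongr
  refine ⟨h, hF, ?_⟩
  rw [Polynomial.eval_mul, Polynomial.eval_mul, Polynomial.eval_mul, Polynomial.eval_add,
    Polynomial.eval_mul, Polynomial.eval_ofNat, Polynomial.eval_ofNat, Polynomial.eval_one,
    familyBound]
  gcongr

section Order

variable [LinearOrder D] {R : Set Word}

/-- The induced cores of a query are of polynomial size. -/
theorem exists_bound_inducedCores (hcode : Function.Injective code)
    (hR : ∀ a b : D, tuple [code a, code b] ∈ R ↔ a ≤ b) :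
    ∃ p : Polynomial ℕ, ∀ q : Query D, ∀ C ∈ q.inducedCores,
      (encQuery code C).length ≤ p.eval (encQuery code q).length := by
  obtain ⟨pA, pF, pM, hb⟩ := exists_bounds
  have e := polyFun_entries (PolyFun.id (O := ∅))
  obtain ⟨p, hp⟩ := (polyFun_inducedWord e.1 e.2.1 e.2.2).length_le
  refine ⟨p.comp (2 * (Polynomial.X + pF + pM) + 3), fun q C hC => ?_⟩
  obtain ⟨h, F, hh, hF, -, hC⟩ := exists_coreTest hcode hR hC
  obtain ⟨-, h1, h2⟩ := hb (encQuery code q)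
  have := hp (tuple [encQuery code q, h, F])
  simp only [hd_tuple_cons, tl_tuple_cons, hC] at this
  refine this.trans ?_
  rw [Polynomial.eval_comp]
  refine eval_mono p ?_
  simp [tuple, length_block]
  omega

/-- Remove a leading `false`. -/
def strip (x : Word) : Word := if x = false :: x.tail then x.tail else x

theorem polyFun_strip {O : Set Word} {x : Word → Word} (hx : PolyFun O x) :
    PolyFun O (fun v => strip (x v)) :=
  (polyDec_isConst hx).ite (p := fun v => x v = false :: (x v).tail) (PolyFun.tail.comp hx) hx

/-- A language in `Σᵖ₂` that advises the search for an induced core. -/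
theorem exists_core_oracle (hcode : Function.Injective code) (hP : InP R)
    (hR : ∀ a b : D, tuple [code a, code b] ∈ R ↔ a ≤ b) :
    ∃ O : Set Word, InSigma 2 O ∧ ∀ (q : Query D) (z : Word),
      (false :: (block z ++ encQuery code q) ∈ O ↔ z.reverse ∈ encQuery code '' q.inducedCores) ∧
      (z ≠ [] → (block z ++ encQuery code q ∈ O ↔
        ∃ y, z.reverse ++ y ∈ encQuery code '' q.inducedCores)) := by
  obtain ⟨pA, pF, pM, hb⟩ := exists_bounds
  obtain ⟨pC, hpC⟩ := exists_bound_inducedCores hcode hR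
  have hRdec := PolyDec.of_inP hP
  let N : Word → Word → Word → Prop := fun x u v =>
    CoreTest R (tl (strip x)) (hd u) (hd (tl u)) (hd v) (hd (tl v)) ∧
    (hd (strip x)).reverse ++ hd (tl (tl u)) =
      inducedWord (tl (strip x)) (hd u) (hd (tl u)) ∧
    (x = false :: x.tail → hd (tl (tl u)) = [])
  have hN : PolyDec ∅ (fun y => N (hd (hd y)) (hd (tl (hd y))) (hd (tl y))) := by
    have hx : PolyFun ∅ (fun y => hd (hd y)) := PolyFun.hd.comp PolyFun.hd
    have hu := polyFun_entries (PolyFun.hd.comp (PolyFun.tl.comp (PolyFun.hd (O := ∅))))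
    have hv := polyFun_entries (PolyFun.hd.comp (PolyFun.tl (O := ∅)))
    have hw := PolyFun.tl.comp (polyFun_strip hx)
    exact (polyDec_coreTest hRdec hw hu.1 hu.2.1 hv.1 hv.2.1).and ((PolyDec.eq
      ((PolyFun.reverse.comp (PolyFun.hd.comp (polyFun_strip hx))).append hu.2.2)
      (polyFun_inducedWord hw hu.1 hu.2.1)).and
      ((polyDec_isConst hx).imp (PolyDec.eq hu.2.2 (PolyFun.const []))))
  refine ⟨_, inSigma_two hN (2 * (pF + pM + pC) + 3) (4 * pF + 2), ?_⟩
  have key : ∀ (q : Query D) (z x : Word), strip x = block z ++ encQuery code q →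
      (encQuery code q).length ≤ x.length →
      ((∃ u : Word, u.length ≤ (2 * (pF + pM + pC) + 3).eval x.length ∧
        ∀ v : Word, v.length ≤ (4 * pF + 2).eval (tuple [x, u]).length → N x u v) ↔
      ∃ y, z.reverse ++ y ∈ encQuery code '' q.inducedCores ∧
        (x = false :: x.tail → y = [])) := by
    intro q z x hx hlen
    simp only [N, hx, hd_block_append, tl_block_append]
    obtain ⟨-, h1, h2⟩ := hb (encQuery code q)
    constructor
    · rintro ⟨u, -, hu⟩
      refine ⟨hd (tl (tl u)), ?_, (hu [] (by simp)).2.2⟩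
      rw [(hu [] (by simp)).2.1]
      obtain ⟨C, hC, hCw⟩ := exists_core_of_coreTest (h := hd u) (F := hd (tl u)) hcode hR
        (fun g L hg hL => by
          have := (hu (tuple [g, L]) ?_).1
          · simpa using this
          · have hm := eval_mono pF (show (encQuery code q).length ≤ (tuple [x, u]).length by
              rw [length_tuple_pair]; omega)
            rw [length_tuple_pair g L]
            simp only [Polynomial.eval_add, Polynomial.eval_mul, Polynomial.eval_ofNat]
            omega)
      exact ⟨C, hC, hCw.symm⟩
    · rintro ⟨y, ⟨C, hC, hCy⟩, hy⟩
      obtain ⟨h, F, hh, hF, htest, hind⟩ := exists_coreTest hcode hR hC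
      refine ⟨tuple [h, F, y], ?_, fun v _ => ?_⟩
      · have hCl := hpC q C hC
        rw [hCy, List.length_append] at hCl
        have m1 := eval_mono pF hlen
        have m2 := eval_mono pM hlen
        have m3 := eval_mono pC hlen
        simp [tuple, length_block]
        omega
      · simp only [hd_tuple_cons, tl_tuple_cons]
        exact ⟨htest _ _, by rw [hind, hCy], hy⟩
  intro q z
  constructor
  · refine (key q z (false :: (block z ++ encQuery code q)) (by simp [strip])
      (by simp; omega)).trans ?_
    simp
  · intro hz
    obtain ⟨b, z', rfl⟩ := List.exists_cons_of_ne_nil hz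
    refine (key q (b :: z') (block (b :: z') ++ encQuery code q) (by simp [strip, block_cons])
      (by simp)).trans ?_
    simp [block_cons]

/-- A language in `Σᵖ₂` that answers whether two queries have isomorphic induced cores. -/
theorem exists_iso_oracle (hcode : Function.Injective code) (hP : InP R)
    (hR : ∀ a b : D, tuple [code a, code b] ∈ R ↔ a ≤ b) :
    ∃ O : Set Word, InSigma 2 O ∧ ∀ p : Query D × Query D, encQueryPair code p ∈ O ↔
      ∃ C₁ ∈ p.1.inducedCores, ∃ C₂ ∈ p.2.inducedCores, Isomorphic C₁ C₂ := by
  obtain ⟨pA, pF, pM, hb⟩ := exists_bounds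
  obtain ⟨pC, hpC⟩ := exists_bound_inducedCores hcode hR
  have hRdec := PolyDec.of_inP hP
  let N : Word → Word → Word → Prop := fun x u v =>
    CoreTest R (hd x) (hd (hd u)) (hd (tl (hd u))) (hd v) (hd (tl v)) ∧
    CoreTest R (hd (tl x)) (hd (hd (tl u))) (hd (tl (hd (tl u)))) (hd v) (hd (tl v)) ∧
    IsoTest (inducedWord (hd x) (hd (hd u)) (hd (tl (hd u))))
      (inducedWord (hd (tl x)) (hd (hd (tl u))) (hd (tl (hd (tl u))))) (hd (tl (tl u)))
  have hN : PolyDec ∅ (fun y => N (hd (hd y)) (hd (tl (hd y))) (hd (tl y))) := by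
    have hx := polyFun_entries (PolyFun.hd.comp (PolyFun.hd (O := ∅)))
    have hu := polyFun_entries (PolyFun.hd.comp (PolyFun.tl.comp (PolyFun.hd (O := ∅))))
    have hu₁ := polyFun_entries hu.1
    have hu₂ := polyFun_entries hu.2.1
    have hv := polyFun_entries (PolyFun.hd.comp (PolyFun.tl (O := ∅)))
    exact (polyDec_coreTest hRdec hx.1 hu₁.1 hu₁.2.1 hv.1 hv.2.1).and
      ((polyDec_coreTest hRdec hx.2.1 hu₂.1 hu₂.2.1 hv.1 hv.2.1).and
        (polyDec_isoTest (polyFun_inducedWord hx.1 hu₁.1 hu₁.2.1)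
          (polyFun_inducedWord hx.2.1 hu₂.1 hu₂.2.1) hu.2.2))
  let pB := pA.comp pC
  refine ⟨_, inSigma_two hN (8 * (pF + pM) + 11 + 2 * (pB * (6 * pB + 3))) (4 * pF + 2),
    fun p => ?_⟩
  set x := encQueryPair code p with hx
  have hx1 : hd x = encQuery code p.1 := hd_tuple_cons _ _
  have hx2 : hd (tl x) = encQuery code p.2 := by simp [hx, encQueryPair]
  have hlen : x.length = 2 * (encQuery code p.1).length + 2 * (encQuery code p.2).length + 2 :=
    length_tuple_pair _ _
  have hl1 : (encQuery code p.1).length ≤ x.length := by omega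
  have hl2 : (encQuery code p.2).length ≤ x.length := by omega
  rw [Set.mem_ofPred_eq]
  simp only [N, hx1, hx2]
  constructor
  · rintro ⟨u, -, hu⟩
    have hv : ∀ (q : Query D) (g L : Word), (encQuery code q).length ≤ x.length →
        g.length ≤ funBound (encQuery code q) → L.length ≤ funBound (encQuery code q) →
        (tuple [g, L]).length ≤ (4 * pF + 2).eval (tuple [x, u]).length := by
      intro q g L hq hg hL
      have h1 := (hb (encQuery code q)).2.1
      have hm := eval_mono pF (show (encQuery code q).length ≤ (tuple [x, u]).length by
        rw [length_tuple_pair]; omega)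
      rw [length_tuple_pair g L]
      simp only [Polynomial.eval_add, Polynomial.eval_mul, Polynomial.eval_ofNat]
      omega
    obtain ⟨C₁, hC₁, hw₁⟩ := exists_core_of_coreTest (h := hd (hd u)) (F := hd (tl (hd u)))
      hcode hR (fun g L hg hL => by simpa using (hu _ (hv p.1 g L hl1 hg hL)).1)
    obtain ⟨C₂, hC₂, hw₂⟩ := exists_core_of_coreTest (h := hd (hd (tl u)))
      (F := hd (tl (hd (tl u)))) hcode hR
      (fun g L hg hL => by simpa using (hu _ (hv p.2 g L hl2 hg hL)).2.1)
    have hiso := (hu [] (by simp)).2.2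
    rw [hw₁, hw₂] at hiso
    exact ⟨C₁, hC₁, C₂, hC₂, isomorphic_of_isoTest hcode hiso⟩
  · rintro ⟨C₁, hC₁, C₂, hC₂, hiso⟩
    obtain ⟨h₁, F₁, hh₁, hF₁, htest₁, hind₁⟩ := exists_coreTest hcode hR hC₁
    obtain ⟨h₂, F₂, hh₂, hF₂, htest₂, hind₂⟩ := exists_coreTest hcode hR hC₂
    have hadom : ∀ (q C : Query D), C ∈ q.inducedCores → (encQuery code q).length ≤ x.length →
        (adomWord (encQuery code C)).length ≤ pB.eval x.length := by
      intro q C hC hq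
      rw [Polynomial.eval_comp]
      exact (hb _).1.trans (eval_mono pA ((hpC q C hC).trans (eval_mono pC hq)))
    obtain ⟨f, hf, hftest⟩ := exists_isoTest hcode hiso (hadom _ _ hC₁ hl1) (hadom _ _ hC₂ hl2)
    refine ⟨tuple [tuple [h₁, F₁], tuple [h₂, F₂], f], ?_, fun v _ => ?_⟩
    · have b₁ := hb (encQuery code p.1)
      have b₂ := hb (encQuery code p.2)
      have m₁ := eval_mono pF hl1
      have m₂ := eval_mono pF hl2
      have m₃ := eval_mono pM hl1
      have m₄ := eval_mono pM hl2
      have : (tuple [tuple [h₁, F₁], tuple [h₂, F₂], f]).length =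
          4 * (h₁.length + F₁.length + h₂.length + F₂.length) + 2 * f.length + 11 := by
        simp [tuple, length_block]; ring
      rw [this]
      simp only [Polynomial.eval_add, Polynomial.eval_mul, Polynomial.eval_ofNat]
      omega
    · simp only [hd_tuple_cons, tl_tuple_cons, hind₁, hind₂]
      exact ⟨htest₁ _ _, htest₂ _ _, hftest⟩

end Order

end CQC

theorem mainTheorem5 {D : Type*} [LinearOrder D] [DenselyOrdered D]
    (code : D → PH.Word) (hcode : Function.Injective code)
    (hle : ∃ L : Set PH.Word, PH.InP L ∧ ∀ a b : D, PH.tuple [code a, code b] ∈ L ↔ a ≤ b) :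
    ∃ core : CQC.Query D → CQC.Query D,
      (∀ q, CQC.IsCore q (core q)) ∧
      PH.ComputableInDelta (CQC.encQuery code) (CQC.encQuery code) core 3 ∧
      PH.DecidableInDelta (CQC.encQueryPair code)
        (fun p => CQC.Isomorphic (core p.1) (core p.2)) 3 := by
  classical
  obtain ⟨R, hP, hR⟩ := hle
  obtain ⟨O, hO, hadvice⟩ := CQC.exists_core_oracle hcode hP hR
  obtain ⟨pC, hpC⟩ := CQC.exists_bound_inducedCores hcode hR
  obtain ⟨P, p, hsearch⟩ := PH.exists_search (O := O) (CQC.encQuery code)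
    (fun q => CQC.encQuery code '' q.inducedCores) pC
    (fun q => (CQC.inducedCores_nonempty q).image _)
    (by rintro q _ ⟨C, hC, rfl⟩; exact hpC q C hC)
    (fun q z => (hadvice q z).1) (fun q z => (hadvice q z).2)
  have hcore : ∀ q : CQC.Query D, ∃ C ∈ q.inducedCores, ∃ (s : PH.Store) (t : ℕ),
      PH.Exec O P (PH.initial (CQC.encQuery code q)) s t ∧
        t ≤ p.eval (CQC.encQuery code q).length ∧ s 0 = CQC.encQuery code C := by
    intro q
    obtain ⟨_, ⟨C, hC, rfl⟩, h⟩ := hsearch q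
    exact ⟨C, hC, h⟩
  choose core hmem hrun using hcore
  have hiscore : ∀ q, CQC.IsCore q (core q) := fun q =>
    CQC.isCore_of_mem_inducedCores (hmem q)
  refine ⟨core, hiscore, ⟨O, hO, P, p, hrun⟩, ?_⟩
  obtain ⟨O', hO', hiso⟩ := CQC.exists_iso_oracle hcode hP hR
  refine ⟨fun p => decide (CQC.Isomorphic (core p.1) (core p.2)), by simp, O', hO',
    PH.Prog.ask 0, 1, fun p => ?_⟩
  have hmem' : CQC.encQueryPair code p ∈ O' ↔ CQC.Isomorphic (core p.1) (core p.2) := by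
    rw [hiso]
    constructor
    · rintro ⟨C₁, hC₁, C₂, hC₂, h⟩
      exact (((hiscore _).isomorphic (CQC.isCore_of_mem_inducedCores hC₁)).trans h).trans
        ((CQC.isCore_of_mem_inducedCores hC₂).isomorphic (hiscore _))
    · exact fun h => ⟨_, hmem _, _, hmem _, h⟩
  by_cases h : CQC.Isomorphic (core p.1) (core p.2)
  · refine ⟨_, 1, PH.Exec.askYes ?_, by simp, by simp [h]⟩
    simpa [PH.initial] using hmem'.2 h
  · refine ⟨_, 1, PH.Exec.askNo ?_, by simp, by simp [h]⟩
    simpa [PH.initial] using fun h' => h (hmem'.1 h')
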